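/- Let $n\ge 1$. The $n$-dimensional simplicial associahedron is the simplicial complex $\Delta_n$ whose faces are the sets of pairwise noncrossing internal diagonals of a convex $(n+3)$-gon. For a simplicial complex $K$ (with $\varnothing\in K$), a face $f\ne\varnothing$ of $K$ and a new vertex $a$, the stellar subdivision of $f$ in $K$ is $$\{g\in K: f\not\subseteq g\}\cup\{g\cup\{a\}: g\in K,\ f\cup g\in K,\ f\not\subseteq g\}.$$ Truncating a face $F$ of a polytope $P$ means intersecting $P$ with a closed half-space whose bounding hyperplane strictly separates $F$, which is cut off, from all vertices of $P$ not in $F$. Let $e_1,\dots,e_n$ be the canonical basis of $\mathbb R^n$, and let $(i_1,j_1),\dots,(i_m,j_m)$, $m=n(n-1)/2$, be the pairs $(i,j)$ with $1\le i<j\le n$, ordered by decreasing $i$ and, for equal $i$, by increasing $j$. There are simplicial complexes $K_0,\dots,K_m$ whose vertices are vectors of $\mathbb R^n$, and polytopes $P_0,\dots,P_m$ in $\mathbb R^n$, such that the following hold. 1. (Stellar subdivisions.) $K_0$ is the boundary complex of the $n$-dimensional cross-polytope with vertices $\pm e_1,\dots,\pm e_n$. For $1\le k\le m$, the pair $\{e_{i_k},-e_{j_k}\}$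 is an edge of $K_{k-1}$, the vector $e_{i_k}-e_{j_k}$ is not a vertex of $K_{k-1}$, and $K_k$ is the stellar subdivision of this edge in $K_{k-1}$ with subdivision vertex $e_{i_k}-e_{j_k}$. The complex $K_m$ is isomorphic to $\Delta_n$. Thus the $n$-dimensional simplicial associahedron is obtained from the boundary of the $n$-dimensional cross-polytope by successive stellar subdivisions of edges. 2. (Truncations.) $P_0$ is the cube $[-1,1]^n$. For $1\le k\le m$, $P_k$ is obtained from $P_{k-1}$ by truncating a face of codimension $2$, namely the one with outer normal cone $\operatorname{cone}\{e_{i_k},-e_{j_k}\}$. The poset of nonempty faces of $P_m$ (including $P_m$ itself) is anti-isomorphic to the poset of faces of $\Delta_n$ (including $\varnothing$). Thus the polar dual of the simplicial associahedron is obtained from the $n$-cube by successive truncations of codimension-$2$ faces. 3. (Loday's realization.) For $0\le k\le m$, the vertices of $K_k$ are the rays of a complete simplicial fan realizing $K_k$, with cones $\operatorname{cone}(s)$, $s\in K_k$, and this fan is the (outer) normal fan of $P_k$. For $k=m$ this fan is, up to a linear isomorphism, the normal fan of Loday's associahedron: there is a surjective linear map $L:\mathbb R^{n+1}\to\mathbb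 R^n$ with kernel $\mathbb R(1,\dots,1)$ such that the normal fan of Loday's associahedron is $\{L^{-1}(\operatorname{cone}(s)): s\in K_m\}$. Here Loday's associahedron is the convex hull in $\mathbb R^{n+1}$ of the points $(a_1(t)b_1(t),\dots,a_{n+1}(t)b_{n+1}(t))$ over all binary trees $t$ with $n+1$ internal nodes, where $a_i(t)$ and $b_i(t)$ are the numbers of leaves in the left and in the right subtree of the $i$-th internal node of $t$ in infix order. -/

import Mathlib

/-! ### Abstract simplicial complexes

A simplicial complex on a vertex type `V` is a set of finite subsets of `V` closed under taking
subsets, that is, an element of `LowerSet (Finset V)`. The empty set is a face of every complex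
that has a face. -/

/-- The vertices of a complex: the points whose singleton is a face. -/
def complexVertices {V : Type*} (K : LowerSet (Finset V)) : Set V :=
  {v | {v} ∈ K}

/-- Two complexes are isomorphic if some bijection of their vertices preserves and reflects
being a face. -/
def ComplexIso {V W : Type*} (K : LowerSet (Finset V)) (L : LowerSet (Finset W)) : Prop :=
  ∃ φ : complexVertices K ≃ complexVertices L, ∀ s : Finset (complexVertices K),
    s.map (Function.Embedding.subtype _) ∈ K ↔
      (s.map φ.toEmbedding).map (Function.Embedding.subtype _) ∈ L

open Classical in
/-- The two-element set `{u, v}`. -/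
noncomputable def edge {V : Type*} (u v : V) : Finset V := {u, v}

open Classical in
/-- The stellar subdivision of the face `f` in `K` with subdivision vertex `a`: the faces of `K`
that do not contain `f`, together with the sets `g ∪ {a}` where `g` is in the star of `f` and does
not contain `f`. It is meant for a nonempty face `f` of `K` and a point `a` that is not a vertex
of `K`. -/
def stellarSubdivision {V : Type*} (K : LowerSet (Finset V)) (f : Finset V) (a : V) :
    LowerSet (Finset V) where
  carrier := {g | g ∈ K ∧ ¬ f ⊆ g} ∪
    {h | ∃ g : Finset V, g ∈ K ∧ f ∪ g ∈ K ∧ ¬ f ⊆ g ∧ h = insert a g}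
  lower' := by
    rintro h h' hle (⟨hK, hf⟩ | ⟨g, hg, hfg, hf, rfl⟩)
    · exact Or.inl ⟨K.lower hle hK, fun hc => hf (hc.trans hle)⟩
    · by_cases ha : a ∈ h'
      · have hs : h'.erase a ⊆ g := by
          intro x hx
          rcases Finset.mem_insert.1 (hle (Finset.mem_of_mem_erase hx)) with rfl | hxg
          · exact absurd rfl (Finset.ne_of_mem_erase hx)
          · exact hxg
        exact Or.inr ⟨h'.erase a, K.lower hs hg,
          K.lower (Finset.union_subset_union_right hs) hfg,
          fun hc => hf (hc.trans hs), (Finset.insert_erase ha).symm⟩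
      · have hs : h' ⊆ g := by
          intro x hx
          rcases Finset.mem_insert.1 (hle hx) with rfl | hxg
          · exact absurd hx ha
          · exact hxg
        exact Or.inl ⟨K.lower hs hg, fun hc => hf (hc.trans hs)⟩

/-! ### The simplicial associahedron -/

/-- `(a, b)` with `a < b` is an internal diagonal of the convex polygon with `n + 3` vertices
labelled cyclically by `Fin (n + 3)`: the vertices `a` and `b` are not neighbours. -/
def IsDiagonal {n : ℕ} (d : Fin (n + 3) × Fin (n + 3)) : Prop :=
  (d.1 : ℕ) + 1 < d.2 ∧ ¬ ((d.1 : ℕ) = 0 ∧ (d.2 : ℕ) = n + 2)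

/-- Two diagonals cross if their endpoints alternate around the polygon. -/
def Crosses {n : ℕ} (d e : Fin (n + 3) × Fin (n + 3)) : Prop :=
  (d.1 < e.1 ∧ e.1 < d.2 ∧ d.2 < e.2) ∨ (e.1 < d.1 ∧ d.1 < e.2 ∧ e.2 < d.2)

/-- The `n`-dimensional simplicial associahedron: the complex of sets of pairwise noncrossing
internal diagonals of a convex `(n + 3)`-gon. -/
def associahedron (n : ℕ) : LowerSet (Finset (Fin (n + 3) × Fin (n + 3))) where
  carrier := {s | (∀ d ∈ s, IsDiagonal d) ∧ ∀ d ∈ s, ∀ e ∈ s, ¬ Crosses d e}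
  lower' := fun _ _ hle h =>
    ⟨fun d hd => h.1 d (hle hd), fun d hd e he => h.2 d (hle hd) e (hle he)⟩

/-! ### The cross-polytope and the cube -/

/-- The `i`-th vector of the canonical basis of `ℝⁿ`. -/
noncomputable def basisVec {n : ℕ} (i : Fin n) : EuclideanSpace ℝ (Fin n) :=
  EuclideanSpace.single i 1

/-- The boundary complex of the `n`-dimensional cross-polytope with vertices `± e_i`: its faces are
the sets of vertices that contain no two opposite ones. -/
def crossPolytopeBoundary (n : ℕ) : LowerSet (Finset (EuclideanSpace ℝ (Fin n))) where
  carrier := {s | (∀ v ∈ s, ∃ i, v = basisVec i ∨ v = -basisVec i) ∧ ∀ v ∈ s, -v ∉ s}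
  lower' := fun _ _ hle h =>
    ⟨fun v hv => h.1 v (hle hv), fun v hv hc => h.2 v (hle hv) (hle hc)⟩

/-- The `n`-dimensional cube `[-1, 1]ⁿ`. -/
def cube (n : ℕ) : Set (EuclideanSpace ℝ (Fin n)) :=
  {x | ∀ i, |x i| ≤ 1}

/-! ### Fans -/

/-- The set of the cones spanned by the faces of a complex whose vertices are vectors. -/
def coneFan {E : Type*} [AddCommGroup E] [Module ℝ E] (K : LowerSet (Finset E)) : Set (Set E) :=
  {C | ∃ s ∈ K, C = (PointedCone.hull ℝ (s : Set E) : Set E)}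

/-- The vertices of `K`, which are vectors, are the rays of a complete simplicial fan
realizing `K`: the faces of `K` span simplicial cones, the cones of two faces meet in the cone of
their intersection, and the cones cover the space. -/
structure RealizesCompleteSimplicialFan {E : Type*} [AddCommGroup E] [Module ℝ E]
    (K : LowerSet (Finset E)) : Prop where
  simplicial : ∀ s ∈ K, LinearIndepOn ℝ id (s : Set E)
  inter : ∀ s ∈ K, ∀ t ∈ K,
    (PointedCone.hull ℝ (s : Set E) : Set E) ∩ (PointedCone.hull ℝ (t : Set E) : Set E) =
      (PointedCone.hull ℝ ((s : Set E) ∩ (t : Set E)) : Set E)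
  complete : ∀ x : E, ∃ s ∈ K, x ∈ PointedCone.hull ℝ (s : Set E)

/-! ### Polytopes: faces, normal fans, truncations -/

/-- The nonempty faces of a polytope `P` (with `P` itself among them): the sets of maximizers on
`P` of linear functionals. -/
def IsFace {E : Type*} [NormedAddCommGroup E] [InnerProductSpace ℝ E] (P F : Set E) : Prop :=
  F.Nonempty ∧ ∃ c : E, F = {x ∈ P | ∀ y ∈ P, inner ℝ c y ≤ inner ℝ c x}

/-- The (outer) normal cone of a face `F` of `P`: the vectors whose maximum over `P` is attained at
all points of `F`. -/
def normalCone {E : Type*} [NormedAddCommGroup E] [InnerProductSpace ℝ E] (P F : Set E) : Set E :=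
  {c | ∀ x ∈ F, ∀ y ∈ P, inner ℝ c y ≤ inner ℝ c x}

/-- The normal fan of `P`: the set of the normal cones of its nonempty faces. -/
def normalFan {E : Type*} [NormedAddCommGroup E] [InnerProductSpace ℝ E] (P : Set E) :
    Set (Set E) :=
  {C | ∃ F, IsFace P F ∧ C = normalCone P F}

/-- `P'` is obtained from `P` by truncating the face `F`: it is the intersection of `P` with a
closed half-space whose bounding hyperplane strictly separates `F` from the vertices of `P` that
are not in `F`, the face `F` being cut off. -/
def IsTruncation {E : Type*} [NormedAddCommGroup E] [InnerProductSpace ℝ E] (P F P' : Set E) :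
    Prop :=
  ∃ (c : E) (b : ℝ), P' = P ∩ {x | inner ℝ c x ≤ b} ∧
    (∀ x ∈ F, b < inner ℝ c x) ∧
    ∀ v ∈ Set.extremePoints ℝ P, v ∉ F → inner ℝ c v < b

/-! ### Loday's realization of the associahedron -/

/-- The coordinates of the point of a binary tree: listed in infix order, the `i`-th one is the
number of leaves on the left of the `i`-th internal node times the number of leaves on its
right. -/
def lodayCoords : BinaryTree Unit → List ℕ
  | .nil => []
  | .node _ l r => lodayCoords l ++ (l.numLeaves * r.numLeaves) :: lodayCoords r

/-- The `n`-dimensional associahedron of Loday: the convex hull in `ℝⁿ⁺¹` of the points of the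
binary trees with `n + 1` internal nodes. -/
def lodayAssociahedron (n : ℕ) : Set (EuclideanSpace ℝ (Fin (n + 1))) :=
  convexHull ℝ {x | ∃ t : BinaryTree Unit, t.numNodes = n + 1 ∧
    x = WithLp.toLp 2 (fun i : Fin (n + 1) => ((lodayCoords t).getD i 0 : ℝ))}

/-! ### The order of the subdivisions -/

/-- The pairs `(i, j)` with `i < j`, ordered by decreasing `i`, and for each `i` by
increasing `j`. -/
def fatteningPairs (n : ℕ) : List (Fin n × Fin n) :=
  (List.finRange n).reverse.flatMap fun i =>
    ((List.finRange n).filter fun j => i < j).map fun j => (i, j)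

/-! ### Complete simplicial fans and stellar subdivision -/

section Fans

variable {E : Type*} [AddCommGroup E] [Module ℝ E]

/-! Put e_0 = e_{n+1} = 0. A label (i, j) with 0 ≤ i < j ≤ n + 1, other than (0, n + 1), encodes
three things: the vector e_i - e_j, the diagonal joining the polygon vertices i and j + 1, and the
interval of positions i ≤ k < j in Loday's coordinates. The diagonals of (i, j) and (k, l) cross iff
i < k ≤ j < l or the same with the roles exchanged.

The intermediate complexes are flag complexes `rootComplex n S`, with S the set of inner pairs
already treated. Crossing labels are incompatible, except that e_i and -e_j with i < j stay
compatible until (i, j) enters S. For S empty this is the cross-polytope, for S full the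
associahedron. In the prescribed order, an old vertex is compatible with the new vertex e_i - e_j
iff it is compatible with both e_i and -e_j (`not_conflict_link_iff`); by flagness, adding (i, j) is
then the stellar subdivision of that edge (`rootComplex_insert`).

Since the new vertex is the sum of the ends of the edge, unique positive representability of vectors
survives the subdivision (`HasUniqueConeReps.stellarSubdivision`), and it is equivalent in strength
to what a complete simplicial fan requires. Dually, if the supporting hyperplanes have levels h,
cutting by u + v ≤ b with b slightly below h u + h v truncates the face dual to the edge
(`exists_truncation_of_stellarSubdivision`).

Polytopes and complexes are compared through `ExposesFaces`: given unique representations, one point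
per face of K at which exactly the vertices of that face are maximal determines the face poset and
the normal fan. For Loday's polytope, `le_blockSum` bounds interval sums, with equality at the
subtrees, and averages of tree points supply the required points (`exists_mem_loday_tight`). -/

theorem mem_stellarSubdivision_edge {V : Type*} [inst : DecidableEq V]
    {K : LowerSet (Finset V)} {u v a : V} {h : Finset V} :
    h ∈ stellarSubdivision K (edge u v) a ↔ (h ∈ K ∧ ¬ (u ∈ h ∧ v ∈ h)) ∨
      ∃ g k : Finset V, k ∈ K ∧ u ∈ k ∧ v ∈ k ∧ g ⊆ k ∧ ¬ (u ∈ g ∧ v ∈ g) ∧ h = insert a g := by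
  -- `edge` and `stellarSubdivision` use classical decidable equality; identifying the given
  -- instance with it makes the criterion usable with any instance.
  obtain rfl : inst = fun a b => Classical.propDecidable (a = b) := Subsingleton.elim _ _
  classical
  have key : ∀ s : Finset V, edge u v ⊆ s ↔ u ∈ s ∧ v ∈ s := by
    intro s
    simp [edge, Finset.insert_subset_iff]
  constructor
  · rintro (⟨h1, h2⟩ | ⟨g, hg, hfg, hf, rfl⟩)
    · exact Or.inl ⟨h1, by rwa [key] at h2⟩
    · rw [key] at hf
      exact Or.inr ⟨g, _, hfg, by simp [edge], by simp [edge], Finset.subset_union_right, hf, rfl⟩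
  · rintro (⟨h1, h2⟩ | ⟨g, k, hk, hu, hv, hgk, hf, rfl⟩)
    · exact Or.inl ⟨h1, by rwa [key]⟩
    · refine Or.inr ⟨g, K.lower hgk hk, K.lower (Finset.union_subset ?_ hgk) hk, by rwa [key], rfl⟩
      exact (key k).2 ⟨hu, hv⟩

/-- `c` writes `x` as a positive combination of the vertices of a face of `K`. -/
structure IsConeRep (K : LowerSet (Finset E)) (x : E) (c : E →₀ ℝ) : Prop where
  nonneg : ∀ v, 0 ≤ c v
  support_mem : c.support ∈ K
  sum_eq : Finsupp.linearCombination ℝ id c = x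

/-- Every vector is in a unique way a positive combination of the vertices of a face of `K`. -/
def HasUniqueConeReps (K : LowerSet (Finset E)) : Prop :=
  ∀ x, ∃! c, IsConeRep K x c

theorem mem_hull_finset_iff {s : Finset E} {x : E} :
    x ∈ PointedCone.hull ℝ (s : Set E) ↔
      ∃ c : E →₀ ℝ, (∀ v, 0 ≤ c v) ∧ c.support ⊆ s ∧ Finsupp.linearCombination ℝ id c = x := by
  classical
  constructor
  · intro hx
    induction hx using Submodule.span_induction with
    | mem y hy =>
      refine ⟨Finsupp.single y 1, fun v => ?_, ?_, by simp⟩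
      · rw [Finsupp.single_apply]; split_ifs <;> norm_num
      · exact Finsupp.support_single_subset.trans (by simpa using hy)
    | zero => exact ⟨0, by simp, by simp, by simp⟩
    | add y z _ _ hy hz =>
      obtain ⟨c, hc, hcs, rfl⟩ := hy
      obtain ⟨d, hd, hds, rfl⟩ := hz
      exact ⟨c + d, fun v => add_nonneg (hc v) (hd v),
        Finsupp.support_add.trans (Finset.union_subset hcs hds), by simp⟩
    | smul r y _ hy =>
      obtain ⟨c, hc, hcs, rfl⟩ := hy
      refine ⟨(r : ℝ) • c, fun v => mul_nonneg r.2 (hc v),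
        Finsupp.support_smul.trans hcs, ?_⟩
      rw [map_smul]; rfl
  · rintro ⟨c, hc, hcs, rfl⟩
    rw [Finsupp.linearCombination_apply, Finsupp.sum]
    refine Submodule.sum_mem _ fun v hv => ?_
    exact Submodule.smul_mem _ (⟨c v, hc v⟩ : {r : ℝ // 0 ≤ r})
      (Submodule.subset_span (hcs hv))

theorem HasUniqueConeReps.mem_hull_iff {K : LowerSet (Finset E)} (hK : HasUniqueConeReps K)
    {s : Finset E} (hs : s ∈ K) {x : E} {c : E →₀ ℝ} (hc : IsConeRep K x c) :
    x ∈ PointedCone.hull ℝ (s : Set E) ↔ c.support ⊆ s := by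
  rw [mem_hull_finset_iff]
  constructor
  · rintro ⟨d, hd, hds, hdx⟩
    rwa [(hK x).unique hc ⟨hd, K.lower hds hs, hdx⟩]
  · exact fun h => ⟨c, hc.nonneg, h, hc.sum_eq⟩

/-- The positive and negative parts of a linear relation on a face represent the same vector, so
they agree and the relation is trivial. Membership in the cone of a face is containment of the
support of the representation, so cones meet as the faces do. -/
theorem HasUniqueConeReps.realizes {K : LowerSet (Finset E)} (hK : HasUniqueConeReps K) :
    RealizesCompleteSimplicialFan K where
  simplicial := by
    intro s hs
    rw [linearIndepOn_iff]
    intro l hl hl0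
    rw [Finsupp.mem_supported] at hl
    have hsub : ∀ l' : E →₀ ℝ, (∀ v, l v = 0 → l' v = 0) → l'.support ∈ K := by
      intro l' h
      refine K.lower (fun v hv => ?_) hs
      rw [Finsupp.mem_support_iff] at hv
      exact hl (by simpa using fun h0 => hv (h v h0))
    let p : E →₀ ℝ := l.mapRange (fun r => max r 0) (by simp)
    let q : E →₀ ℝ := l.mapRange (fun r => max (-r) 0) (by simp)
    have hpq : l = p - q := by
      ext v
      simp only [p, q, Finsupp.sub_apply, Finsupp.mapRange_apply]
      rcases le_total 0 (l v) with h | h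
      · rw [max_eq_left h, max_eq_right (by linarith)]; ring
      · rw [max_eq_right h, max_eq_left (by linarith)]; ring
    have hp : IsConeRep K (Finsupp.linearCombination ℝ id p) p :=
      ⟨fun v => by simp [p], hsub p fun v h => by simp [p, h], rfl⟩
    have hq : IsConeRep K (Finsupp.linearCombination ℝ id p) q := by
      refine ⟨fun v => by simp [q], hsub q fun v h => by simp [q, h], ?_⟩
      rw [hpq, map_sub, sub_eq_zero] at hl0
      exact hl0.symm
    rw [hpq, (hK _).unique hp hq, sub_self]
  inter := by
    classical
    intro s hs t ht
    ext x
    obtain ⟨c, hc, -⟩ := hK x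
    have hst : s ∩ t ∈ K := K.lower Finset.inter_subset_left hs
    rw [← Finset.coe_inter]
    simp only [Set.mem_inter_iff, SetLike.mem_coe, hK.mem_hull_iff hs hc, hK.mem_hull_iff ht hc,
      hK.mem_hull_iff hst hc, Finset.subset_inter_iff]
  complete := by
    intro x
    obtain ⟨c, hc, -⟩ := hK x
    exact ⟨c.support, hc.support_mem, (hK.mem_hull_iff hc.support_mem hc).2 subset_rfl⟩

/-- With m = min (c u) (c v), trading m • u + m • v for m • (u + v) removes u or v from the support.
Conversely, the coefficient of u + v can be merged back into u and v. As u and v never occur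
together in the subdivision, that coefficient is the minimum of the two merged ones, so the merged
representation determines the original. -/
theorem HasUniqueConeReps.stellarSubdivision {K : LowerSet (Finset E)} (hK : HasUniqueConeReps K)
    {u v : E} (huv : u ≠ v) (he : edge u v ∈ K) (ha : u + v ∉ complexVertices K) :
    HasUniqueConeReps (stellarSubdivision K (edge u v) (u + v)) := by
  classical
  have hnot : ∀ s ∈ K, u + v ∉ s := fun s hs hx =>
    ha (K.lower (Finset.singleton_subset_iff.2 hx) hs)
  have hau : u ≠ u + v := fun h => hnot _ he (by rw [← h]; simp [edge])
  have hav : v ≠ u + v := fun h => hnot _ he (by rw [← h]; simp [edge])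
  -- merging the multiple of the new vertex into the two old ones
  let B : (E →₀ ℝ) → (E →₀ ℝ) := fun c =>
    c - Finsupp.single (u + v) (c (u + v)) + Finsupp.single u (c (u + v))
      + Finsupp.single v (c (u + v))
  have hBsum : ∀ c, Finsupp.linearCombination ℝ id (B c) = Finsupp.linearCombination ℝ id c := by
    intro c
    simp only [B, map_add, map_sub, Finsupp.linearCombination_single, id, smul_add]
    abel
  have hBx : ∀ c x, x ≠ u + v → x ≠ u → x ≠ v → B c x = c x := by
    intro c x h1 h2 h3
    simp [B, h1.symm, h2.symm, h3.symm]
  have hBa : ∀ c, B c (u + v) = 0 := by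
    intro c
    simp only [B, Finsupp.add_apply, Finsupp.sub_apply, Finsupp.single_apply, if_neg hau,
      if_neg hav]
    simp
  have hBu : ∀ c, B c u = c u + c (u + v) := by
    intro c
    simp only [B, Finsupp.add_apply, Finsupp.sub_apply, Finsupp.single_apply, if_neg hau.symm,
      if_neg huv.symm]
    simp
  have hBv : ∀ c, B c v = c v + c (u + v) := by
    intro c
    simp only [B, Finsupp.add_apply, Finsupp.sub_apply, Finsupp.single_apply, if_neg hav.symm,
      if_neg huv]
    simp
  have hmin : ∀ {x c}, IsConeRep (_root_.stellarSubdivision K (edge u v) (u + v)) x c →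
      c u = 0 ∨ c v = 0 := by
    intro x c hc
    by_contra! h
    rcases mem_stellarSubdivision_edge.1 hc.support_mem with ⟨-, h2⟩ | ⟨g, k, -, -, -, -, hg, hh⟩
    · exact h2 (by simpa using h)
    · apply hg
      have hu : u ∈ c.support := by simpa using h.1
      have hv : v ∈ c.support := by simpa using h.2
      rw [hh, Finset.mem_insert] at hu hv
      exact ⟨hu.resolve_left hau, hv.resolve_left hav⟩
  have hB : ∀ {x c}, IsConeRep (_root_.stellarSubdivision K (edge u v) (u + v)) x c →
      IsConeRep K x (B c) := by
    intro x c hc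
    refine ⟨fun w => ?_, ?_, (hBsum c).trans hc.sum_eq⟩
    · by_cases h1 : w = u + v
      · rw [h1, hBa]
      by_cases h2 : w = u
      · rw [h2, hBu]; exact add_nonneg (hc.nonneg _) (hc.nonneg _)
      by_cases h3 : w = v
      · rw [h3, hBv]; exact add_nonneg (hc.nonneg _) (hc.nonneg _)
      rw [hBx c w h1 h2 h3]; exact hc.nonneg _
    · rcases mem_stellarSubdivision_edge.1 hc.support_mem with
        ⟨h1, -⟩ | ⟨g, k, hk, hu, hv, hgk, -, hh⟩
      · have h0 : c (u + v) = 0 := by simpa using hnot _ h1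
        simpa [B, h0] using h1
      · refine K.lower (fun w hw => ?_) hk
        rw [Finsupp.mem_support_iff] at hw
        by_cases h1 : w = u + v
        · rw [h1, hBa] at hw; exact absurd rfl hw
        by_cases h2 : w = u
        · rwa [h2]
        by_cases h3 : w = v
        · rwa [h3]
        rw [hBx c w h1 h2 h3, ← Finsupp.mem_support_iff, hh, Finset.mem_insert] at hw
        exact hgk (hw.resolve_left h1)
  have hmin' : ∀ {x c}, IsConeRep (_root_.stellarSubdivision K (edge u v) (u + v)) x c →
      c (u + v) = min (B c u) (B c v) := by
    intro x c hc
    rw [hBu, hBv]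
    have h1 := hc.nonneg u
    have h2 := hc.nonneg v
    rcases hmin hc with h | h
    · rw [h, min_eq_left (by linarith)]; ring
    · rw [h, min_eq_right (by linarith)]; ring
  intro x
  obtain ⟨c, hc, hcu⟩ := hK x
  set m := min (c u) (c v) with hm
  have hm0 : 0 ≤ m := le_min (hc.nonneg u) (hc.nonneg v)
  have hca : c (u + v) = 0 := by simpa using hnot _ hc.support_mem
  let d : E →₀ ℝ :=
    c - Finsupp.single u m - Finsupp.single v m + Finsupp.single (u + v) m
  have hdx : ∀ x, x ≠ u + v → x ≠ u → x ≠ v → d x = c x := by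
    intro x h1 h2 h3
    simp [d, h1.symm, h2.symm, h3.symm]
  have hda : d (u + v) = m := by
    simp only [d, Finsupp.add_apply, Finsupp.sub_apply, Finsupp.single_apply, if_neg hau,
      if_neg hav, hca]
    simp
  have hdu : d u = c u - m := by
    simp only [d, Finsupp.add_apply, Finsupp.sub_apply, Finsupp.single_apply, if_neg hau.symm,
      if_neg huv.symm]
    simp
  have hdv : d v = c v - m := by
    simp only [d, Finsupp.add_apply, Finsupp.sub_apply, Finsupp.single_apply, if_neg hav.symm,
      if_neg huv]
    simp
  have hd : IsConeRep (_root_.stellarSubdivision K (edge u v) (u + v)) x d := by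
    refine ⟨fun w => ?_, ?_, ?_⟩
    · by_cases h1 : w = u + v
      · rwa [h1, hda]
      by_cases h2 : w = u
      · rw [h2, hdu, sub_nonneg]; exact min_le_left _ _
      by_cases h3 : w = v
      · rw [h3, hdv, sub_nonneg]; exact min_le_right _ _
      rw [hdx w h1 h2 h3]; exact hc.nonneg _
    · rw [mem_stellarSubdivision_edge]
      rcases hm0.eq_or_lt with h0 | hpos
      · left
        have hdc : d = c := by simp [d, ← h0]
        rw [hdc]
        refine ⟨hc.support_mem, ?_⟩
        rintro ⟨h1, h2⟩
        rw [Finsupp.mem_support_iff] at h1 h2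
        rcases min_choice (c u) (c v) with h | h <;> rw [← hm, ← h0] at h
        · exact h1 h.symm
        · exact h2 h.symm
      · right
        refine ⟨d.support.erase (u + v), c.support, hc.support_mem, ?_, ?_, ?_, ?_, ?_⟩
        · rw [Finsupp.mem_support_iff]
          exact (hpos.trans_le (min_le_left _ _)).ne'
        · rw [Finsupp.mem_support_iff]
          exact (hpos.trans_le (min_le_right _ _)).ne'
        · intro w hw
          rw [Finset.mem_erase, Finsupp.mem_support_iff] at hw
          rw [Finsupp.mem_support_iff]
          by_cases h2 : w = u
          · rw [h2]; exact (hpos.trans_le (min_le_left _ _)).ne'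
          by_cases h3 : w = v
          · rw [h3]; exact (hpos.trans_le (min_le_right _ _)).ne'
          rw [← hdx w hw.1 h2 h3]; exact hw.2
        · rintro ⟨h1, h2⟩
          rw [Finset.mem_erase, Finsupp.mem_support_iff] at h1 h2
          rw [hdu] at h1
          rw [hdv] at h2
          rcases min_choice (c u) (c v) with h | h <;> rw [← hm] at h
          · exact h1.2 (by rw [h, sub_self])
          · exact h2.2 (by rw [h, sub_self])
        · rw [Finset.insert_erase]
          rw [Finsupp.mem_support_iff, hda]
          exact hpos.ne'
    · rw [← hc.sum_eq]
      simp only [d, map_add, map_sub, Finsupp.linearCombination_single, id, smul_add]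
      abel
  refine ⟨d, hd, fun c' hc' => ?_⟩
  have hBB : B c' = B d := (hK x).unique (hB hc') (hB hd)
  have h1 : c' (u + v) = d (u + v) := by rw [hmin' hc', hmin' hd, hBB]
  ext w
  by_cases hw1 : w = u + v
  · rw [hw1, h1]
  by_cases hw2 : w = u
  · have := hBu c'
    rw [hBB, hBu, h1] at this
    rw [hw2]; linarith
  by_cases hw3 : w = v
  · have := hBv c'
    rw [hBB, hBv, h1] at this
    rw [hw3]; linarith
  rw [← hBx c' w hw1 hw2 hw3, hBB, hBx d w hw1 hw2 hw3]

end Fans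

theorem singleton_mem_of_mem {V : Type*} {K : LowerSet (Finset V)} {s : Finset V} (hs : s ∈ K)
    {v : V} (hv : v ∈ s) : {v} ∈ K :=
  K.lower (Finset.singleton_subset_iff.2 hv) hs

/-! ### Face posets and normal fans from exposing points -/

section NormalFans

variable {W : Type*} [NormedAddCommGroup W] [InnerProductSpace ℝ W]
  {E : Type*} [AddCommGroup E] [Module ℝ E]

/-- The functional `c` attains its maximum over `P` at `x`. -/
def Maximizes (P : Set W) (c x : W) : Prop :=
  ∀ y ∈ P, inner ℝ c y ≤ inner ℝ c x

/-- The face of `P` on which all functionals lying over the points of `s` are maximal. -/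
def dualFace (L : W →ₗ[ℝ] E) (P : Set W) (s : Finset E) : Set W :=
  {x ∈ P | ∀ v ∈ s, ∀ c, L c = v → Maximizes P c x}

/-- Modulo the kernel of `L`, every face of `K` is the set of vertices that are maximal at some
point of `P`. -/
structure ExposesFaces (L : W →ₗ[ℝ] E) (P : Set W) (K : LowerSet (Finset E)) : Prop where
  surjective : Function.Surjective L
  inner_eq : ∀ c, L c = 0 → ∀ x ∈ P, ∀ y ∈ P, inner ℝ c x = inner ℝ c y
  exists_point : ∀ s ∈ K, ∃ x ∈ P, ∀ v, {v} ∈ K → ((∀ c, L c = v → Maximizes P c x) ↔ v ∈ s)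

namespace ExposesFaces

variable {L : W →ₗ[ℝ] E} {P : Set W} {K : LowerSet (Finset E)}

/-- Up to a functional constant on P, c is a positive combination of lifts of the vertices in the
support of r. These lifts have a common maximizer z, so the combination is maximal at x iff each
term is. -/
theorem maximizes_iff (h : ExposesFaces L P K) {c : W} {r : E →₀ ℝ} (hr : IsConeRep K (L c) r)
    {x : W} (hx : x ∈ P) :
    Maximizes P c x ↔ ∀ v ∈ r.support, ∀ d, L d = v → Maximizes P d x := by
  obtain ⟨M, hM⟩ := h.surjective.hasRightInverse
  have hMd : ∀ x ∈ P, ∀ d, Maximizes P (M (L d)) x → Maximizes P d x := by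
    intro x hx d hd y hy
    have h1 := h.inner_eq (d - M (L d)) (by rw [map_sub, hM, sub_self]) x hx y hy
    rw [inner_sub_left, inner_sub_left] at h1
    linarith [hd y hy]
  have hdec : ∀ x ∈ P, ∀ y ∈ P, inner ℝ c y - inner ℝ c x =
      ∑ v ∈ r.support, r v * (inner ℝ (M v) y - inner ℝ (M v) x) := by
    intro x hx y hy
    have h1 := h.inner_eq (c - ∑ v ∈ r.support, r v • M v) (by
      rw [map_sub, map_sum, sub_eq_zero, ← hr.sum_eq, Finsupp.linearCombination_apply, Finsupp.sum]
      refine Finset.sum_congr rfl fun v _ => ?_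
      rw [map_smul, hM]; rfl) x hx y hy
    rw [inner_sub_left, inner_sub_left, sum_inner, sum_inner] at h1
    simp only [mul_sub, Finset.sum_sub_distrib, real_inner_smul_left] at h1 ⊢
    linarith
  constructor
  · intro hmax
    obtain ⟨z, hz, hzs⟩ := h.exists_point _ hr.support_mem
    have hzv : ∀ v ∈ r.support, Maximizes P (M v) z := fun v hv =>
      (hzs v (singleton_mem_of_mem hr.support_mem hv)).2 hv _ (hM v)
    have hnonpos : ∀ v ∈ r.support, r v * (inner ℝ (M v) x - inner ℝ (M v) z) ≤ 0 := fun v hv =>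
      mul_nonpos_of_nonneg_of_nonpos (hr.nonneg v) (sub_nonpos.2 (hzv v hv x hx))
    have hsum : ∑ v ∈ r.support, r v * (inner ℝ (M v) x - inner ℝ (M v) z) = 0 := by
      refine le_antisymm (Finset.sum_nonpos hnonpos) ?_
      rw [← hdec z hz x hx, sub_nonneg]
      exact hmax z hz
    intro v hv d hd
    have hv0 := (Finset.sum_eq_zero_iff_of_nonpos hnonpos).1 hsum v hv
    have hxz : inner ℝ (M v) x = inner ℝ (M v) z := by
      rcases mul_eq_zero.1 hv0 with h0 | h0
      · exact absurd h0 (Finsupp.mem_support_iff.1 hv)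
      · linarith
    refine hMd x hx d fun y hy => ?_
    rw [hd, hxz]
    exact hzv v hv y hy
  · intro hall y hy
    rw [← sub_nonpos, hdec x hx y hy]
    refine Finset.sum_nonpos fun v hv => ?_
    exact mul_nonpos_of_nonneg_of_nonpos (hr.nonneg v) (sub_nonpos.2 (hall v hv _ (hM v) y hy))

theorem setOf_maximizes_eq (h : ExposesFaces L P K) {c : W} {r : E →₀ ℝ}
    (hr : IsConeRep K (L c) r) :
    {x ∈ P | ∀ y ∈ P, inner ℝ c y ≤ inner ℝ c x} = dualFace L P r.support := by
  ext x
  simp only [dualFace, Set.mem_ofPred_eq]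
  exact and_congr_right fun hx => h.maximizes_iff hr hx

/-- A vector with prescribed support of its representation. -/
theorem exists_isConeRep (h : ExposesFaces L P K) {s : Finset E} (hs : s ∈ K) :
    ∃ c r, IsConeRep K (L c) r ∧ r.support = s := by
  classical
  let r : E →₀ ℝ := Finsupp.indicator s fun _ _ => 1
  have hrs : r.support = s := by
    ext v
    rw [Finsupp.mem_support_iff, Finsupp.indicator_apply]
    by_cases hv : v ∈ s <;> simp [hv]
  obtain ⟨c, hc⟩ := h.surjective (Finsupp.linearCombination ℝ id r)
  refine ⟨c, r, ⟨fun v => ?_, by rwa [hrs], hc.symm⟩, hrs⟩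
  rw [Finsupp.indicator_apply]
  split_ifs <;> norm_num

theorem isFace_dualFace (h : ExposesFaces L P K) {s : Finset E} (hs : s ∈ K) :
    IsFace P (dualFace L P s) := by
  obtain ⟨c, r, hr, rfl⟩ := h.exists_isConeRep hs
  obtain ⟨x, hx, hxs⟩ := h.exists_point _ hs
  exact ⟨⟨x, hx, fun v hv => (hxs v (singleton_mem_of_mem hs hv)).2 hv⟩, c, (h.setOf_maximizes_eq hr).symm⟩

theorem exists_eq_dualFace (h : ExposesFaces L P K) (hK : HasUniqueConeReps K) {F : Set W}
    (hF : IsFace P F) : ∃ s ∈ K, F = dualFace L P s := by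
  obtain ⟨-, c, rfl⟩ := hF
  obtain ⟨r, hr, -⟩ := hK (L c)
  exact ⟨_, hr.support_mem, h.setOf_maximizes_eq hr⟩

/-- The exposing point of s lies in the dual face of s and is maximal for no vertex outside s, so it
detects whether t ⊆ s. -/
theorem dualFace_subset_iff (h : ExposesFaces L P K) {s t : Finset E} (hs : s ∈ K) (ht : t ∈ K) :
    dualFace L P s ⊆ dualFace L P t ↔ t ⊆ s := by
  constructor
  · intro hst v hv
    obtain ⟨x, hx, hxs⟩ := h.exists_point _ hs
    have hx' : x ∈ dualFace L P s := ⟨hx, fun v hv => (hxs v (singleton_mem_of_mem hs hv)).2 hv⟩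
    exact (hxs v (singleton_mem_of_mem ht hv)).1 ((hst hx').2 v hv)
  · exact fun hts x hx => ⟨hx.1, fun v hv => hx.2 v (hts hv)⟩

/-- A vector c lies in the normal cone iff the dual face of s is contained in the face maximizing c.
The latter is dual to the support of the representation of L c, so the condition says that this
support lies in s. -/
theorem normalCone_dualFace (h : ExposesFaces L P K) (hK : HasUniqueConeReps K) {s : Finset E}
    (hs : s ∈ K) :
    normalCone P (dualFace L P s) = L ⁻¹' (PointedCone.hull ℝ (s : Set E) : Set E) := by
  ext c
  obtain ⟨r, hr, -⟩ := hK (L c)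
  rw [Set.mem_preimage, SetLike.mem_coe, hK.mem_hull_iff hs hr,
    ← h.dualFace_subset_iff hs hr.support_mem, ← h.setOf_maximizes_eq hr]
  exact ⟨fun hc x hx => ⟨hx.1, hc x hx⟩, fun hc x hx => (hc hx).2⟩

theorem normalFan_eq (h : ExposesFaces L P K) (hK : HasUniqueConeReps K) :
    normalFan P = (fun C => L ⁻¹' C) '' coneFan K := by
  ext C
  constructor
  · rintro ⟨F, hF, rfl⟩
    obtain ⟨s, hs, rfl⟩ := h.exists_eq_dualFace hK hF
    exact ⟨_, ⟨s, hs, rfl⟩, (h.normalCone_dualFace hK hs).symm⟩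
  · rintro ⟨_, ⟨s, hs, rfl⟩, rfl⟩
    exact ⟨_, h.isFace_dualFace hs, (h.normalCone_dualFace hK hs).symm⟩

/-- The faces of `P` are anti-isomorphic to those of `K`. -/
theorem nonempty_orderIso (h : ExposesFaces L P K) (hK : HasUniqueConeReps K) :
    Nonempty (Kᵒᵈ ≃o {F // IsFace P F}) := by
  let f : Kᵒᵈ ↪o {F // IsFace P F} := OrderEmbedding.ofMapLEIff
    (fun s => ⟨dualFace L P (OrderDual.ofDual s).1, h.isFace_dualFace (OrderDual.ofDual s).2⟩)
    fun s t => h.dualFace_subset_iff (OrderDual.ofDual s).2 (OrderDual.ofDual t).2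
  refine ⟨RelIso.ofSurjective f ?_⟩
  rintro ⟨F, hF⟩
  obtain ⟨s, hs, rfl⟩ := h.exists_eq_dualFace hK hF
  exact ⟨OrderDual.toDual ⟨s, hs⟩, rfl⟩

end ExposesFaces

end NormalFans

/-! ### Polytopes given by support numbers -/

section SupportedPolytopes

variable {E : Type*} [NormedAddCommGroup E] [InnerProductSpace ℝ E]

/-- The polyhedron whose outer facet normals are the vertices of `K`, with support numbers `h`. -/
def supportedPolytope (K : LowerSet (Finset E)) (h : E → ℝ) : Set E :=
  {x | ∀ v, {v} ∈ K → inner ℝ v x ≤ h v}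

/-- At `x` precisely the inequalities given by the vertices of `s` are tight. -/
def TightExactly (K : LowerSet (Finset E)) (h : E → ℝ) (s : Finset E) (x : E) : Prop :=
  ∀ v, {v} ∈ K → (v ∈ s → inner ℝ v x = h v) ∧ (v ∉ s → inner ℝ v x < h v)

variable {K : LowerSet (Finset E)} {h : E → ℝ}

theorem TightExactly.mem {s : Finset E} {x : E} (hx : TightExactly K h s x) :
    x ∈ supportedPolytope K h := fun v hv => by
  by_cases hvs : v ∈ s
  · exact ((hx v hv).1 hvs).le
  · exact ((hx v hv).2 hvs).le

/-- Each bound h v is attained, at a point tight exactly for {v}. Hence maximality in direction v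
means tightness of its inequality. -/
theorem exposesFaces_supportedPolytope (hx : ∀ s ∈ K, ∃ x, TightExactly K h s x) :
    ExposesFaces LinearMap.id (supportedPolytope K h) K where
  surjective := Function.surjective_id
  inner_eq := by
    rintro c rfl x - y -
    simp
  exists_point := by
    intro s hs
    obtain ⟨x, hxs⟩ := hx s hs
    refine ⟨x, hxs.mem, fun v hv => ⟨fun hmax => ?_, ?_⟩⟩
    · by_contra hvs
      obtain ⟨y, hy⟩ := hx _ hv
      have h1 := hmax v rfl y hy.mem
      rw [(hy v hv).1 (Finset.mem_singleton_self v)] at h1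
      exact absurd ((hxs v hv).2 hvs) h1.not_gt
    · rintro hvs c rfl y hy
      rw [LinearMap.id_apply] at hvs hv
      rw [(hxs c hv).1 hvs]
      exact hy c hv

theorem mem_dualFace_supportedPolytope_iff (hx : ∀ s ∈ K, ∃ x, TightExactly K h s x)
    {s : Finset E} (hs : s ∈ K) {y : E} :
    y ∈ dualFace LinearMap.id (supportedPolytope K h) s ↔
      y ∈ supportedPolytope K h ∧ ∀ v ∈ s, inner ℝ v y = h v := by
  refine and_congr_right fun hy => forall₂_congr fun v hv => ?_
  have hvK := singleton_mem_of_mem hs hv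
  constructor
  · intro hmax
    obtain ⟨z, hz⟩ := hx _ hvK
    refine le_antisymm (hy v hvK) ?_
    rw [← (hz v hvK).1 (Finset.mem_singleton_self v)]
    exact hmax v rfl z hz.mem
  · rintro heq c rfl z hz
    rw [LinearMap.id_apply] at heq hvK
    rw [heq]
    exact hz c hvK

end SupportedPolytopes

/-! ### Truncation dual to the subdivision of an edge -/

section TruncationStep

open Filter Topology

variable {E : Type*} [NormedAddCommGroup E] [InnerProductSpace ℝ E] [FiniteDimensional ℝ E]
  {K : LowerSet (Finset E)} {h : E → ℝ}

/-- The directions of the face form the orthogonal complement of the span of s: from a point where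
only s is tight, a small move orthogonal to s respects the finitely many other inequalities, which
are strict. -/
theorem finrank_vectorSpan_dualFace (hfin : (complexVertices K).Finite)
    (hx : ∀ s ∈ K, ∃ x, TightExactly K h s x) {s : Finset E} (hs : s ∈ K)
    (hind : LinearIndepOn ℝ id (s : Set E)) :
    Module.finrank ℝ (vectorSpan ℝ (dualFace LinearMap.id (supportedPolytope K h) s)) + s.card =
      Module.finrank ℝ E := by
  have hspan : vectorSpan ℝ (dualFace LinearMap.id (supportedPolytope K h) s) =
      (Submodule.span ℝ (s : Set E))ᗮ := by
    apply le_antisymm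
    · rw [vectorSpan_def, Submodule.span_le]
      rintro _ ⟨y, hy, z, hz, rfl⟩
      rw [mem_dualFace_supportedPolytope_iff hx hs] at hy hz
      rw [SetLike.mem_coe, Submodule.mem_orthogonal]
      intro w hw
      induction hw using Submodule.span_induction with
      | mem w hw => simp only [vsub_eq_sub, inner_sub_right, hy.2 w hw, hz.2 w hw, sub_self]
      | zero => simp
      | add a b _ _ ha hb => rw [inner_add_left, ha, hb, add_zero]
      | smul r a _ ha => rw [real_inner_smul_left, ha, mul_zero]
    · intro d hd
      have hds : ∀ v ∈ s, inner ℝ v d = (0 : ℝ) := fun v hv =>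
        (Submodule.mem_orthogonal _ _).1 hd v (Submodule.subset_span hv)
      obtain ⟨x, hxs⟩ := hx s hs
      have hev : ∀ᶠ t : ℝ in 𝓝[>] 0, ∀ v ∈ complexVertices K, v ∉ s →
          inner ℝ v (x + t • d) < h v := by
        refine (eventually_all_finite hfin).2 fun v hv => ?_
        rw [eventually_imp_distrib_left]
        intro hvs
        refine eventually_nhdsWithin_of_eventually_nhds ?_
        have hcont : Continuous fun t : ℝ => inner ℝ v (x + t • d) := by fun_prop
        refine hcont.continuousAt.eventually_lt continuousAt_const ?_
        simpa using (hxs v hv).2 hvs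
      obtain ⟨t, ht, ht0⟩ := (hev.and self_mem_nhdsWithin).exists
      have hmem : x + t • d ∈ dualFace LinearMap.id (supportedPolytope K h) s := by
        rw [mem_dualFace_supportedPolytope_iff hx hs]
        have heq : ∀ v ∈ s, inner ℝ v (x + t • d) = h v := fun v hv => by
          rw [inner_add_right, inner_smul_right, hds v hv, mul_zero, add_zero,
            (hxs v (singleton_mem_of_mem hs hv)).1 hv]
        refine ⟨fun v hv => ?_, heq⟩
        by_cases hvs : v ∈ s
        · exact (heq v hvs).le
        · exact (ht v hv hvs).le
      have hxmem : x ∈ dualFace LinearMap.id (supportedPolytope K h) s := by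
        rw [mem_dualFace_supportedPolytope_iff hx hs]
        exact ⟨hxs.mem, fun v hv => (hxs v (singleton_mem_of_mem hs hv)).1 hv⟩
      have htd := vsub_mem_vectorSpan ℝ hmem hxmem
      rw [vsub_eq_sub, add_sub_cancel_left] at htd
      exact (Submodule.smul_mem_iff _ (Set.mem_Ioi.1 ht0).ne').1 htd
  have hcard : Module.finrank ℝ (Submodule.span ℝ (s : Set E)) = s.card :=
    finrank_span_finset_eq_card hind
  rw [hspan, ← hcard, add_comm]
  exact Submodule.finrank_add_finrank_orthogonal _

/-- The polytope is spanned by one point of each face, so these include its vertices. -/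
theorem extremePoints_supportedPolytope_subset (hK : HasUniqueConeReps K)
    (hfaces : {s | s ∈ K}.Finite) {p : Finset E → E} (hp : ∀ s ∈ K, TightExactly K h s (p s)) :
    Set.extremePoints ℝ (supportedPolytope K h) ⊆ p '' {s | s ∈ K} := by
  have hx : ∀ s ∈ K, ∃ x, TightExactly K h s x := fun s hs => ⟨_, hp s hs⟩
  -- A point outside the hull would be separated from it by a vector c, but c is maximal over the
  -- polytope at the chosen point of the face supporting its representation.
  have hhull : supportedPolytope K h ⊆ convexHull ℝ (p '' {s | s ∈ K}) := by
    intro w hw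
    by_contra hwn
    obtain ⟨f, r, hf, hfw⟩ := geometric_hahn_banach_closed_point (convex_convexHull ℝ (p '' {s | s ∈ K}))
      ((hfaces.image p).isClosed_convexHull ℝ) hwn
    obtain ⟨c, rfl⟩ := (InnerProductSpace.toDual ℝ E).surjective f
    simp only [InnerProductSpace.toDual_apply_apply] at hf hfw
    obtain ⟨l, hl, -⟩ := hK c
    have hmem := hp _ hl.support_mem
    have hmax : Maximizes (supportedPolytope K h) c (p l.support) := by
      rw [(exposesFaces_supportedPolytope hx).maximizes_iff hl hmem.mem]
      refine ((mem_dualFace_supportedPolytope_iff hx hl.support_mem).2 ⟨hmem.mem, fun v hv => ?_⟩).2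
      exact (hmem v (singleton_mem_of_mem hl.support_mem hv)).1 hv
    have h1 := hmax w hw
    have h2 := hf _ (subset_convexHull ℝ _ ⟨_, hl.support_mem, rfl⟩)
    linarith
  have heq : supportedPolytope K h = convexHull ℝ (p '' {s | s ∈ K}) := by
    refine hhull.antisymm (convexHull_min ?_ ?_)
    · rintro _ ⟨s, hs, rfl⟩
      exact (hp s hs).mem
    · intro x hx y hy a b ha hb hab v hv
      rw [inner_add_right, inner_smul_right, inner_smul_right]
      calc a * inner ℝ v x + b * inner ℝ v y ≤ a * h v + b * h v := by
            gcongr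
            · exact hx v hv
            · exact hy v hv
        _ = h v := by rw [← add_mul, hab, one_mul]
  rw [heq]
  exact extremePoints_convexHull_subset

theorem singleton_mem_stellarSubdivision_edge_iff {V : Type*} {K : LowerSet (Finset V)}
    {u v a w : V} (huv : u ≠ v) (he : edge u v ∈ K) :
    {w} ∈ stellarSubdivision K (edge u v) a ↔ {w} ∈ K ∨ w = a := by
  classical
  rw [mem_stellarSubdivision_edge]
  constructor
  · rintro (⟨h1, -⟩ | ⟨g, k, -, -, -, -, -, hw⟩)
    · exact Or.inl h1
    · refine Or.inr (Finset.mem_singleton.1 ?_).symm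
      rw [hw]
      exact Finset.mem_insert_self _ _
  · rintro (h1 | rfl)
    · refine Or.inl ⟨h1, fun h => huv ?_⟩
      rw [Finset.mem_singleton.1 h.1, Finset.mem_singleton.1 h.2]
    · exact Or.inr ⟨∅, edge u v, he, by simp [edge], by simp [edge], by simp, by simp, by simp⟩

/-- The functional u + v reaches h u + h v only where both u and v are tight. A cut slightly below
this level removes the dual face of the edge and keeps the chosen points of all faces not containing
the edge, hence all other vertices. -/
theorem exists_truncation_of_stellarSubdivision (hK : HasUniqueConeReps K)
    (hfin : (complexVertices K).Finite) (hx : ∀ s ∈ K, ∃ x, TightExactly K h s x) {u v : E}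
    (huv : u ≠ v) (he : edge u v ∈ K) (ha : u + v ∉ complexVertices K) :
    ∃ h' : E → ℝ,
      (∀ s ∈ stellarSubdivision K (edge u v) (u + v), ∃ x,
        TightExactly (stellarSubdivision K (edge u v) (u + v)) h' s x) ∧
      IsTruncation (supportedPolytope K h)
        (dualFace LinearMap.id (supportedPolytope K h) (edge u v))
        (supportedPolytope (stellarSubdivision K (edge u v) (u + v)) h') := by
  classical
  have hvert := @singleton_mem_stellarSubdivision_edge_iff E K u v (u + v)
  have hnot : ∀ s ∈ K, u + v ∉ s := fun s hs hx => ha (singleton_mem_of_mem hs hx)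
  have hue : u ∈ edge u v := by simp [edge]
  have hve : v ∈ edge u v := by simp [edge]
  have hu := singleton_mem_of_mem he hue
  have hv := singleton_mem_of_mem he hve
  have hfaces : {s | s ∈ K}.Finite := by
    refine (hfin.toFinset.powerset.finite_toSet).subset fun s hs => ?_
    rw [Finset.mem_coe, Finset.mem_powerset]
    exact fun w hw => hfin.mem_toFinset.2 (singleton_mem_of_mem hs hw)
  choose! p hp using hx
  have hx : ∀ s ∈ K, ∃ x, TightExactly K h s x := fun s hs => ⟨_, hp s hs⟩
  have hlt : ∀ s ∈ K, ¬ (u ∈ s ∧ v ∈ s) → inner ℝ (u + v) (p s) < h u + h v := by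
    intro s hs hn
    rw [inner_add_left]
    by_cases hus : u ∈ s
    · exact add_lt_add_of_le_of_lt ((hp s hs).mem u hu) ((hp s hs v hv).2 fun hvs => hn ⟨hus, hvs⟩)
    · exact add_lt_add_of_lt_of_le ((hp s hs u hu).2 hus) ((hp s hs).mem v hv)
  -- There are finitely many faces, so the strict inequalities `hlt` leave room for a common level
  -- b.
  obtain ⟨b, hb, hb'⟩ : ∃ b : ℝ,
      (∀ s ∈ {s | s ∈ K}, ¬ (u ∈ s ∧ v ∈ s) → inner ℝ (u + v) (p s) < b) ∧ b < h u + h v := by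
    have hev : ∀ᶠ b in 𝓝[<] (h u + h v),
        ∀ s ∈ {s | s ∈ K}, ¬ (u ∈ s ∧ v ∈ s) → inner ℝ (u + v) (p s) < b := by
      refine (eventually_all_finite hfaces).2 fun s hs => ?_
      rw [eventually_imp_distrib_left]
      exact fun hn => eventually_nhdsWithin_of_eventually_nhds (eventually_gt_nhds (hlt s hs hn))
    exact (hev.and self_mem_nhdsWithin).exists
  have hne : ∀ w, {w} ∈ K → w ≠ u + v := by
    rintro w hw rfl
    exact ha hw
  refine ⟨Function.update h (u + v) b, ?_, u + v, b, ?_, ?_, ?_⟩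
  · intro s hs
    rcases mem_stellarSubdivision_edge.1 hs with ⟨hsK, hn⟩ | ⟨g, k, hk, huk, hvk, hgk, hn, rfl⟩
    · refine ⟨p s, fun w hw => ?_⟩
      rcases (hvert huv he).1 hw with hwK | rfl
      · rw [Function.update_of_ne (hne w hwK)]
        exact hp s hsK w hwK
      · rw [Function.update_self]
        exact ⟨fun hws => absurd hws (hnot s hsK), fun _ => hb s hsK hn⟩
    · have hg : g ∈ K := K.lower hgk hk
      have hg' : insert u (insert v g) ∈ K :=
        K.lower (Finset.insert_subset huk (Finset.insert_subset hvk hgk)) hk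
      -- The level of u + v is h u + h v > b at y and less than b at z; the parameter θ below picks
      -- the point of level b on the segment. Both ends are tight on g, and θ > 0 makes the old
      -- inequalities outside g strict, including those of u and v when not in g.
      set z := p g
      set y := p (insert u (insert v g))
      have hz : TightExactly K h g z := hp g hg
      have hy : TightExactly K h (insert u (insert v g)) y := hp _ hg'
      have hay : inner ℝ (u + v) y = h u + h v := by
        rw [inner_add_left, (hy u hu).1 (by simp), (hy v hv).1 (by simp)]
      have hzb : inner ℝ (u + v) z < b := hb g hg hn
      set δ := h u + h v - inner ℝ (u + v) z with hδ
      have hδ0 : 0 < δ := by linarith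
      set θ := (h u + h v - b) / δ with hθ
      have hθδ : θ * δ = h u + h v - b := div_mul_cancel₀ _ hδ0.ne'
      have hθ0 : 0 < θ := div_pos (by linarith) hδ0
      have hθ1 : θ < 1 := (div_lt_one hδ0).2 (by linarith)
      have hval : ∀ w, inner ℝ w ((1 - θ) • y + θ • z) =
          (1 - θ) * inner ℝ w y + θ * inner ℝ w z := fun w => by
        rw [inner_add_right, inner_smul_right, inner_smul_right]
      refine ⟨(1 - θ) • y + θ • z, fun w hw => ?_⟩
      rw [hval]
      rcases (hvert huv he).1 hw with hwK | rfl
      · rw [Function.update_of_ne (hne w hwK)]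
        constructor
        · intro hwg
          have hwg' := Finset.mem_of_mem_insert_of_ne hwg (hne w hwK)
          rw [(hz w hwK).1 hwg', (hy w hwK).1 (by simp [hwg'])]
          ring
        · intro hwg
          have h1 := (hz w hwK).2 fun hc => hwg (Finset.mem_insert_of_mem hc)
          have h2 := hy.mem w hwK
          calc (1 - θ) * inner ℝ w y + θ * inner ℝ w z < (1 - θ) * h w + θ * h w :=
                add_lt_add_of_le_of_lt (mul_le_mul_of_nonneg_left h2 (by linarith))
                  (mul_lt_mul_of_pos_left h1 hθ0)
            _ = h w := by ring
      · rw [Function.update_self]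
        refine ⟨fun _ => ?_, fun hc => absurd (Finset.mem_insert_self _ _) hc⟩
        rw [hay]
        linear_combination -hθδ + θ * hδ
  · ext x
    simp only [supportedPolytope, Set.mem_inter_iff, Set.mem_ofPred_eq, hvert huv he]
    constructor
    · intro H
      refine ⟨fun w hw => ?_, ?_⟩
      · have := H w (Or.inl hw)
        rwa [Function.update_of_ne (hne w hw)] at this
      · have := H _ (Or.inr rfl)
        rwa [Function.update_self] at this
    · rintro ⟨h1, h2⟩ w (hw | rfl)
      · rw [Function.update_of_ne (hne w hw)]
        exact h1 w hw
      · rwa [Function.update_self]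
  · intro x hxF
    rw [mem_dualFace_supportedPolytope_iff hx he] at hxF
    rwa [inner_add_left, hxF.2 u hue, hxF.2 v hve]
  · intro w hw hwF
    obtain ⟨s, hs, rfl⟩ := extremePoints_supportedPolytope_subset hK hfaces hp hw
    refine hb s hs fun hn => hwF ?_
    rw [mem_dualFace_supportedPolytope_iff hx he]
    refine ⟨(hp s hs).mem, fun w hw => ?_⟩
    rcases (by simpa [edge] using hw : w = u ∨ w = v) with rfl | rfl
    · exact (hp s hs w hu).1 hn.1
    · exact (hp s hs w hv).1 hn.2

end TruncationStep

/-! ### Flag complexes interpolating between cross-polytope and associahedron -/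

section RootComplex

variable {n : ℕ}

/-- The vectors `0, e₁, …, eₙ, 0, 0, …`. -/
noncomputable def paddedBasis (n i : ℕ) : EuclideanSpace ℝ (Fin n) :=
  WithLp.toLp 2 fun k => if i = (k : ℕ) + 1 then 1 else 0

theorem paddedBasis_apply (i : ℕ) (k : Fin n) :
    paddedBasis n i k = if i = (k : ℕ) + 1 then 1 else 0 := rfl

theorem paddedBasis_zero : paddedBasis n 0 = 0 := by
  ext k
  rw [paddedBasis_apply, if_neg (by omega)]
  rfl

theorem paddedBasis_last : paddedBasis n (n + 1) = 0 := by
  ext k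
  rw [paddedBasis_apply, if_neg (by omega)]
  rfl

theorem paddedBasis_succ (i : Fin n) : paddedBasis n (i + 1) = basisVec i := by
  ext k
  rw [paddedBasis_apply, basisVec, PiLp.single_apply]
  simp [Fin.ext_iff, eq_comm]

/-- The difference vector of a pair of indices. -/
noncomputable def rootVec (n : ℕ) (p : ℕ × ℕ) : EuclideanSpace ℝ (Fin n) :=
  paddedBasis n p.1 - paddedBasis n p.2

theorem rootVec_apply (p : ℕ × ℕ) (k : Fin n) :
    rootVec n p k =
      (if p.1 = (k : ℕ) + 1 then 1 else 0) - (if p.2 = (k : ℕ) + 1 then 1 else 0) := rfl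

theorem rootVec_last (i : Fin n) : rootVec n ((i : ℕ) + 1, n + 1) = basisVec i := by
  rw [rootVec, paddedBasis_last, sub_zero, paddedBasis_succ]

theorem rootVec_zero (i : Fin n) : rootVec n (0, (i : ℕ) + 1) = -basisVec i := by
  rw [rootVec, paddedBasis_zero, zero_sub, paddedBasis_succ]

theorem rootVec_succ (i j : Fin n) :
    rootVec n ((i : ℕ) + 1, (j : ℕ) + 1) = basisVec i + -basisVec j := by
  rw [rootVec, paddedBasis_succ, paddedBasis_succ, sub_eq_add_neg]

/-- The pairs with distinct nonzero vectors. -/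
def IsRoot (n : ℕ) (p : ℕ × ℕ) : Prop :=
  p.1 < p.2 ∧ p.2 ≤ n + 1 ∧ p ≠ (0, n + 1)

/-- A nonzero first index is read off from the entry 1, a second index at most n from the entry -1.
A missing entry means that the index is 0 or n + 1, respectively. -/
theorem rootVec_injOn : Set.InjOn (rootVec n) {p | IsRoot n p} := by
  have hfst : ∀ p q : ℕ × ℕ, IsRoot n p → rootVec n p = rootVec n q → 1 ≤ p.1 → q.1 = p.1 := by
    rintro ⟨i, j⟩ q ⟨h1, h2, -⟩ h hi
    simp only at h1 h2 hi ⊢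
    have := congrArg (fun x => x ⟨i - 1, by omega⟩) h
    simp only [rootVec_apply, Nat.sub_add_cancel hi, if_true] at this
    rw [if_neg (by omega)] at this
    by_contra hc
    rw [if_neg hc] at this
    split_ifs at this <;> norm_num at this
  have hsnd : ∀ p q : ℕ × ℕ, IsRoot n p → rootVec n p = rootVec n q → p.2 ≤ n → q.2 = p.2 := by
    rintro ⟨i, j⟩ q ⟨h1, h2, -⟩ h hj
    simp only at h1 h2 hj ⊢
    have hj1 : 1 ≤ j := by omega
    have := congrArg (fun x => x ⟨j - 1, by omega⟩) h
    simp only [rootVec_apply, Nat.sub_add_cancel hj1, if_true] at this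
    rw [if_neg (by omega)] at this
    by_contra hc
    rw [if_neg hc] at this
    split_ifs at this <;> norm_num at this
  intro p hp q hq h
  have h1 := hfst p q hp h
  have h2 := hfst q p hq h.symm
  have h3 := hsnd p q hp h
  have h4 := hsnd q p hq h.symm
  have hp2 := hp.2.1
  have hq2 := hq.2.1
  ext <;> omega

/-- The pairs of the vertices `± eᵢ`, together with the pairs in `S`. -/
def IsLabel (n : ℕ) (S : Set (ℕ × ℕ)) (p : ℕ × ℕ) : Prop :=
  p ∈ S ∨ (p.1 = 0 ∧ 1 ≤ p.2 ∧ p.2 ≤ n) ∨ (1 ≤ p.1 ∧ p.1 ≤ n ∧ p.2 = n + 1)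

/-- Two pairs are in conflict if they cross, unless they are those of `-eⱼ` and `eₖ` and the
edge between these has not been subdivided. -/
def Conflict (n : ℕ) (S : Set (ℕ × ℕ)) (p q : ℕ × ℕ) : Prop :=
  p.1 < q.1 ∧ q.1 ≤ p.2 ∧ p.2 < q.2 ∧ ¬ (p.1 = 0 ∧ q.2 = n + 1 ∧ q.1 < p.2 ∧ (q.1, p.2) ∉ S)

/-- The flag complex on the labels of `S` given by absence of conflict. -/
def rootComplex (n : ℕ) (S : Set (ℕ × ℕ)) : LowerSet (Finset (EuclideanSpace ℝ (Fin n))) where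
  carrier := {s | (∀ x ∈ s, ∃ p, IsLabel n S p ∧ rootVec n p = x) ∧
    ∀ p q, IsLabel n S p → IsLabel n S q → rootVec n p ∈ s → rootVec n q ∈ s → ¬ Conflict n S p q}
  lower' := fun _ _ hle h =>
    ⟨fun x hx => h.1 x (hle hx), fun p q hp hq hps hqs => h.2 p q hp hq (hle hps) (hle hqs)⟩

theorem mem_rootComplex {S : Set (ℕ × ℕ)} {s : Finset (EuclideanSpace ℝ (Fin n))} :
    s ∈ rootComplex n S ↔ (∀ x ∈ s, ∃ p, IsLabel n S p ∧ rootVec n p = x) ∧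
      ∀ p q, IsLabel n S p → IsLabel n S q → rootVec n p ∈ s → rootVec n q ∈ s →
        ¬ Conflict n S p q := Iff.rfl

/-- The pairs of indices in `1, …, n`. -/
def innerPairs (n : ℕ) : Set (ℕ × ℕ) := {p | 1 ≤ p.1 ∧ p.1 < p.2 ∧ p.2 ≤ n}

theorem IsLabel.isRoot {S : Set (ℕ × ℕ)} (hS : S ⊆ innerPairs n) {p : ℕ × ℕ}
    (hp : IsLabel n S p) : IsRoot n p := by
  obtain ⟨i, j⟩ := p
  simp only [IsLabel, IsRoot, ne_eq, Prod.mk.injEq] at hp ⊢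
  rcases hp with hp | hp
  · obtain ⟨h1, h2, h3⟩ := hS hp
    simp only at h1 h2 h3
    omega
  · omega

theorem singleton_mem_rootComplex_iff {S : Set (ℕ × ℕ)} (hS : S ⊆ innerPairs n)
    {x : EuclideanSpace ℝ (Fin n)} :
    {x} ∈ rootComplex n S ↔ ∃ p, IsLabel n S p ∧ rootVec n p = x := by
  rw [mem_rootComplex]
  refine ⟨fun h => h.1 x (Finset.mem_singleton_self x), fun h => ⟨?_, ?_⟩⟩
  · intro y hy
    rwa [Finset.mem_singleton.1 hy]
  · intro p q hp hq hpx hqx hc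
    rw [Finset.mem_singleton] at hpx hqx
    have := rootVec_injOn (hp.isRoot hS) (hq.isRoot hS) (hpx.trans hqx.symm)
    rw [this] at hc
    exact lt_irrefl _ hc.1

theorem finite_complexVertices_rootComplex {S : Set (ℕ × ℕ)} (hS : S ⊆ innerPairs n) :
    (complexVertices (rootComplex n S)).Finite := by
  refine (((Set.finite_Iic (n + 1)).prod (Set.finite_Iic (n + 1))).image (rootVec n)).subset ?_
  intro x hx
  obtain ⟨p, hp, rfl⟩ := (singleton_mem_rootComplex_iff hS).1 hx
  have h := hp.isRoot hS
  exact ⟨p, ⟨h.1.le.trans h.2.1, h.2.1⟩, rfl⟩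

/-- The inner pairs preceding `(i, j)`: those with larger first entry, or with the same first and
smaller second entry. -/
def pairsBefore (n i j : ℕ) : Set (ℕ × ℕ) :=
  {p | p ∈ innerPairs n ∧ (i < p.1 ∨ (p.1 = i ∧ p.2 < j))}

/-! ### Adding one root is a stellar subdivision -/

section Step

variable {i j : ℕ}

theorem mem_pairsBefore {k l : ℕ} : (k, l) ∈ pairsBefore n i j ↔
    (1 ≤ k ∧ k < l ∧ l ≤ n) ∧ (i < k ∨ (k = i ∧ l < j)) := Iff.rfl

/-- Inserting (i, j) lifts a single exemption, that of the two ends of the subdivided edge. -/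
theorem conflict_insert_iff {p q : ℕ × ℕ} :
    Conflict n (insert (i, j) (pairsBefore n i j)) p q ↔
      Conflict n (pairsBefore n i j) p q ∨
        (p = (0, j) ∧ q = (i, n + 1) ∧ i < j ∧ j ≤ n ∧ 0 < i) := by
  obtain ⟨k, l⟩ := p
  obtain ⟨k', l'⟩ := q
  simp only [Conflict, Set.mem_insert_iff, mem_pairsBefore, Prod.mk.injEq]
  omega

/-- This is where the order matters. An earlier inner pair starts after i, or at i and ends before
j; it never conflicts with e_i, and it conflicts with -e_j iff it crosses (i, j). For w = (0, l) the
exemption against e_i has been lifted exactly for i < l < j, and for w = (k, n + 1) the one against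
-e_j exactly for i < k < j. With the permanent conflicts at l = i and k = j, these are the crossings
with (i, j). -/
theorem not_conflict_link_iff (hi : 1 ≤ i) (hij : i < j) (hj : j ≤ n) {w : ℕ × ℕ}
    (hw : IsLabel n (pairsBefore n i j) w) :
    (¬ Conflict n (insert (i, j) (pairsBefore n i j)) w (i, j) ∧
      ¬ Conflict n (insert (i, j) (pairsBefore n i j)) (i, j) w) ↔
    (¬ Conflict n (pairsBefore n i j) w (i, n + 1) ∧
      ¬ Conflict n (pairsBefore n i j) (i, n + 1) w ∧
      ¬ Conflict n (pairsBefore n i j) w (0, j) ∧ ¬ Conflict n (pairsBefore n i j) (0, j) w) := by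
  obtain ⟨k, l⟩ := w
  simp only [IsLabel, Conflict, Set.mem_insert_iff, mem_pairsBefore, Prod.mk.injEq, true_and,
    and_true] at hw ⊢
  omega

theorem pairsBefore_subset : pairsBefore n i j ⊆ innerPairs n := fun _ h => h.1

/-- Among the old vertices only the subdivided edge becomes forbidden (`hconf`). By flagness, a face
can be joined to both ends of the edge iff each of its vertices is compatible with them, so `hlink`
matches the faces through the new vertex with the star of the edge. -/
theorem rootComplex_insert (hi : 1 ≤ i) (hij : i < j) (hj : j ≤ n) :
    rootComplex n (insert (i, j) (pairsBefore n i j)) =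
      stellarSubdivision (rootComplex n (pairsBefore n i j))
        (edge (rootVec n (i, n + 1)) (rootVec n (0, j))) (rootVec n (i, j)) := by
  classical
  set S := pairsBefore n i j with hS
  set S' := insert (i, j) S with hS'
  have hSin : S ⊆ innerPairs n := pairsBefore_subset
  have hSin' : S' ⊆ innerPairs n := Set.insert_subset ⟨hi, hij, hj⟩ hSin
  have hSS' : ∀ p, IsLabel n S' p ↔ IsLabel n S p ∨ p = (i, j) := fun p => by
    simp only [IsLabel, hS', Set.mem_insert_iff]
    tauto
  have hu : IsLabel n S (i, n + 1) := Or.inr (Or.inr ⟨hi, by simp only; omega, rfl⟩)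
  have hv : IsLabel n S (0, j) := Or.inr (Or.inl ⟨rfl, by simp only; omega, hj⟩)
  have ha : IsLabel n S' (i, j) := (hSS' _).2 (Or.inr rfl)
  have hinj : ∀ {p q}, IsLabel n S' p → IsLabel n S' q → rootVec n p = rootVec n q → p = q :=
    fun hp hq h => rootVec_injOn (hp.isRoot hSin') (hq.isRoot hSin') h
  have hlab : ∀ {s}, s ∈ rootComplex n S → ∀ {p}, IsLabel n S' p → rootVec n p ∈ s →
      IsLabel n S p := by
    intro s hs p hp hps
    obtain ⟨q, hq, hqp⟩ := hs.1 _ hps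
    rwa [hinj hp ((hSS' q).2 (Or.inl hq)) hqp.symm]
  have hconf : ∀ p q, Conflict n S' p q ↔ Conflict n S p q ∨ (p = (0, j) ∧ q = (i, n + 1)) := by
    intro p q
    rw [hS', hS, conflict_insert_iff]
    tauto
  have hlink := @not_conflict_link_iff n i j hi hij hj
  rw [← hS, ← hS'] at hlink
  have huS' := (hSS' _).2 (Or.inl hu)
  have hvS' := (hSS' _).2 (Or.inl hv)
  have haa : ¬ Conflict n S' (i, j) (i, j) := fun h => lt_irrefl _ h.1
  ext g
  rw [SetLike.mem_coe, SetLike.mem_coe, mem_stellarSubdivision_edge]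
  constructor
  · intro hg
    have hnot : ¬ (rootVec n (i, n + 1) ∈ g ∧ rootVec n (0, j) ∈ g) := fun h =>
      hg.2 _ _ hvS' huS' h.2 h.1 ((hconf _ _).2 (Or.inr ⟨rfl, rfl⟩))
    by_cases hag : rootVec n (i, j) ∈ g
    · right
      have hg0 : ∀ x ∈ g.erase (rootVec n (i, j)), ∃ p, IsLabel n S p ∧ rootVec n p = x := by
        intro x hx
        obtain ⟨p, hp, rfl⟩ := hg.1 x (Finset.mem_of_mem_erase hx)
        refine ⟨p, ((hSS' p).1 hp).resolve_right ?_, rfl⟩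
        rintro rfl
        exact absurd rfl (Finset.ne_of_mem_erase hx)
      refine ⟨g.erase (rootVec n (i, j)),
        insert (rootVec n (i, n + 1)) (insert (rootVec n (0, j)) (g.erase (rootVec n (i, j)))),
        ⟨?_, ?_⟩, by simp, by simp, fun x hx => by simp [hx], fun h => hnot
          ⟨Finset.mem_of_mem_erase h.1, Finset.mem_of_mem_erase h.2⟩,
        (Finset.insert_erase hag).symm⟩
      · intro x hx
        rcases Finset.mem_insert.1 hx with rfl | hx
        · exact ⟨_, hu, rfl⟩
        rcases Finset.mem_insert.1 hx with rfl | hx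
        · exact ⟨_, hv, rfl⟩
        · exact hg0 x hx
      · have hcases : ∀ p, IsLabel n S p → rootVec n p ∈ insert (rootVec n (i, n + 1))
            (insert (rootVec n (0, j)) (g.erase (rootVec n (i, j)))) →
            p = (i, n + 1) ∨ p = (0, j) ∨ rootVec n p ∈ g := by
          intro p hp hpk
          have hp' := (hSS' p).2 (Or.inl hp)
          rcases Finset.mem_insert.1 hpk with h | h
          · exact Or.inl (hinj hp' huS' h)
          rcases Finset.mem_insert.1 h with h | h
          · exact Or.inr (Or.inl (hinj hp' hvS' h))
          · exact Or.inr (Or.inr (Finset.mem_of_mem_erase h))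
        have hl : ∀ p, IsLabel n S p → rootVec n p ∈ g → _ := fun p hp hpg =>
          (hlink hp).1 ⟨hg.2 _ _ ((hSS' p).2 (Or.inl hp)) ha hpg hag,
            hg.2 _ _ ha ((hSS' p).2 (Or.inl hp)) hag hpg⟩
        intro p q hp hq hpk hqk
        rcases hcases p hp hpk with rfl | rfl | hpg <;> rcases hcases q hq hqk with rfl | rfl | hqg
        · exact fun h => lt_irrefl _ h.1
        · exact fun h => absurd h.1 (by simp)
        · exact (hl q hq hqg).2.1
        -- The ends of the edge are still exempt, as (i, j) does not precede itself.
        · exact fun h => h.2.2.2 ⟨rfl, rfl, hij, fun h => absurd (mem_pairsBefore.1 h) (by omega)⟩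
        · exact fun h => lt_irrefl _ h.1
        · exact (hl q hq hqg).2.2.2
        · exact (hl p hp hpg).1
        · exact (hl p hp hpg).2.2.1
        · exact fun h => hg.2 p q ((hSS' p).2 (Or.inl hp)) ((hSS' q).2 (Or.inl hq)) hpg hqg
            ((hconf p q).2 (Or.inl h))
    · left
      refine ⟨⟨fun x hx => ?_, fun p q hp hq hpg hqg h => ?_⟩, hnot⟩
      · obtain ⟨p, hp, rfl⟩ := hg.1 x hx
        refine ⟨p, ((hSS' p).1 hp).resolve_right ?_, rfl⟩
        rintro rfl
        exact hag hx
      · exact hg.2 p q ((hSS' p).2 (Or.inl hp)) ((hSS' q).2 (Or.inl hq)) hpg hqg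
            ((hconf p q).2 (Or.inl h))
  · have hold : ∀ s ∈ rootComplex n S,
        ¬ (rootVec n (i, n + 1) ∈ s ∧ rootVec n (0, j) ∈ s) → ∀ p q, IsLabel n S' p →
        IsLabel n S' q → rootVec n p ∈ s → rootVec n q ∈ s → ¬ Conflict n S' p q := by
      intro s hs hn p q hp hq hps hqs hc
      rcases (hconf p q).1 hc with hc | ⟨rfl, rfl⟩
      · exact hs.2 p q (hlab hs hp hps) (hlab hs hq hqs) hps hqs hc
      · exact hn ⟨hqs, hps⟩
    rintro (⟨hg, hn⟩ | ⟨g, k, hk, huk, hvk, hgk, hn, rfl⟩)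
    · refine ⟨fun x hx => ?_, hold g hg hn⟩
      obtain ⟨p, hp, rfl⟩ := hg.1 x hx
      exact ⟨p, (hSS' p).2 (Or.inl hp), rfl⟩
    · have hgS := (rootComplex n S).lower hgk hk
      refine ⟨fun x hx => ?_, fun p q hp hq hpg hqg => ?_⟩
      · rcases Finset.mem_insert.1 hx with rfl | hx
        · exact ⟨_, ha, rfl⟩
        · obtain ⟨p, hp, rfl⟩ := hgS.1 x hx
          exact ⟨p, (hSS' p).2 (Or.inl hp), rfl⟩
      · have hl : ∀ p, IsLabel n S' p → rootVec n p ∈ g → _ := fun p hp hpg =>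
          (hlink (hlab hgS hp hpg)).2 ⟨hk.2 _ _ (hlab hgS hp hpg) hu (hgk hpg) huk,
            hk.2 _ _ hu (hlab hgS hp hpg) huk (hgk hpg),
            hk.2 _ _ (hlab hgS hp hpg) hv (hgk hpg) hvk,
            hk.2 _ _ hv (hlab hgS hp hpg) hvk (hgk hpg)⟩
        have hcases : ∀ p, IsLabel n S' p → rootVec n p ∈ insert (rootVec n (i, j)) g →
            p = (i, j) ∨ rootVec n p ∈ g := fun p hp hpg =>
          (Finset.mem_insert.1 hpg).imp_left fun h => hinj hp ha h
        rcases hcases p hp hpg with rfl | hpg <;> rcases hcases q hq hqg with rfl | hqg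
        · exact haa
        · exact (hl q hq hqg).2
        · exact (hl p hp hpg).1
        · exact hold g hgS hn p q hp hq hpg hqg

theorem edge_mem_rootComplex (hi : 1 ≤ i) (hij : i < j) (hj : j ≤ n) :
    edge (rootVec n (i, n + 1)) (rootVec n (0, j)) ∈ rootComplex n (pairsBefore n i j) := by
  have hu : IsLabel n (pairsBefore n i j) (i, n + 1) :=
    Or.inr (Or.inr ⟨hi, by simp only; omega, rfl⟩)
  have hv : IsLabel n (pairsBefore n i j) (0, j) := Or.inr (Or.inl ⟨rfl, by simp only; omega, hj⟩)
  have hinj : ∀ {p q}, IsLabel n (pairsBefore n i j) p → IsLabel n (pairsBefore n i j) q →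
      rootVec n p = rootVec n q → p = q := fun hp hq h =>
    rootVec_injOn (hp.isRoot pairsBefore_subset) (hq.isRoot pairsBefore_subset) h
  have hmem : ∀ x, x ∈ edge (rootVec n (i, n + 1)) (rootVec n (0, j)) ↔
      x = rootVec n (i, n + 1) ∨ x = rootVec n (0, j) := fun x => by simp [edge]
  refine ⟨fun x hx => ?_, fun p q hp hq hpx hqx hc => ?_⟩
  · rcases (hmem x).1 hx with rfl | rfl
    · exact ⟨_, hu, rfl⟩
    · exact ⟨_, hv, rfl⟩
  · have hp' := ((hmem _).1 hpx).imp (hinj hp hu) (hinj hp hv)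
    have hq' := ((hmem _).1 hqx).imp (hinj hq hu) (hinj hq hv)
    rcases hp' with rfl | rfl <;> rcases hq' with rfl | rfl <;>
      simp only [Conflict, mem_pairsBefore, true_and] at hc <;> omega

theorem rootVec_notMem_complexVertices (hi : 1 ≤ i) (hij : i < j) (hj : j ≤ n) :
    rootVec n (i, j) ∉ complexVertices (rootComplex n (pairsBefore n i j)) := by
  intro h
  obtain ⟨p, hp, hpx⟩ := (singleton_mem_rootComplex_iff pairsBefore_subset).1 h
  have hroot : IsRoot n (i, j) := ⟨hij, hj.trans n.le_succ, by simp; omega⟩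
  obtain rfl := rootVec_injOn (hp.isRoot pairsBefore_subset) hroot hpx
  simp only [IsLabel, mem_pairsBefore] at hp
  omega

end Step

/-! ### The initial complex -/

section CrossPolytope

/-- With no inner pair treated, every crossing of (0, j) with (i, n + 1) for i < j is exempt. Only i
= j remains, which is the conflict of the opposite vertices -e_j and e_j. -/
theorem rootComplex_empty : rootComplex n ∅ = crossPolytopeBoundary n := by
  have hneg : ∀ i : ℕ, rootVec n (0, i) = -rootVec n (i, n + 1) := fun i => by
    rw [rootVec, rootVec, paddedBasis_zero, paddedBasis_last, zero_sub, sub_zero]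
  have hsucc : ∀ i, 1 ≤ i → i ≤ n → ∃ k : Fin n, (k : ℕ) + 1 = i := fun i h1 h2 =>
    ⟨⟨i - 1, by omega⟩, Nat.sub_add_cancel h1⟩
  ext s
  constructor
  · intro hs
    refine ⟨fun v hv => ?_, fun v hv hnv => ?_⟩
    · obtain ⟨⟨i, j⟩, hp, rfl⟩ := hs.1 v hv
      rcases hp with hp | ⟨h1, h2, h3⟩ | ⟨h1, h2, h3⟩
      · exact absurd hp (Set.notMem_empty _)
      · obtain ⟨k, hk⟩ := hsucc j h2 h3
        simp only at h1 hk
        subst h1 hk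
        exact ⟨k, Or.inr (rootVec_zero k)⟩
      · obtain ⟨k, hk⟩ := hsucc i h1 h2
        simp only at h3 hk
        subst h3 hk
        exact ⟨k, Or.inl (rootVec_last k)⟩
    · have key : ∀ i, 1 ≤ i → i ≤ n → rootVec n (0, i) ∈ s → rootVec n (i, n + 1) ∉ s := by
        intro i h1 h2 h3 h4
        refine hs.2 (0, i) (i, n + 1) (Or.inr (Or.inl ⟨rfl, h1, h2⟩))
          (Or.inr (Or.inr ⟨h1, h2, rfl⟩)) h3 h4 ⟨h1, le_rfl, Nat.lt_succ_of_le h2, fun h => ?_⟩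
        exact lt_irrefl _ h.2.2.1
      obtain ⟨⟨i, j⟩, hp, rfl⟩ := hs.1 v hv
      rcases hp with hp | ⟨h1, h2, h3⟩ | ⟨h1, h2, h3⟩
      · exact absurd hp (Set.notMem_empty _)
      · simp only at h1
        subst h1
        refine key j h2 h3 hv ?_
        rwa [hneg, neg_neg] at hnv
      · simp only at h3
        subst h3
        refine key i h1 h2 ?_ hv
        rwa [hneg]
  · intro hs
    refine ⟨fun v hv => ?_, ?_⟩
    · obtain ⟨k, rfl | rfl⟩ := hs.1 v hv
      · exact ⟨((k : ℕ) + 1, n + 1), Or.inr (Or.inr ⟨Nat.succ_pos _, k.2, rfl⟩), rootVec_last k⟩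
      · exact ⟨(0, (k : ℕ) + 1), Or.inr (Or.inl ⟨rfl, Nat.succ_pos _, k.2⟩), rootVec_zero k⟩
    · rintro ⟨i, j⟩ ⟨i', j'⟩ hp hq hps hqs ⟨h1, h2, h3, h4⟩
      simp only [IsLabel, Set.mem_empty_iff_false, false_or] at hp hq h1 h2 h3 h4
      have h5 : i = 0 ∧ j' = n + 1 ∧ i' = j := by
        simp only [not_false_eq_true, and_true] at h4
        omega
      obtain ⟨rfl, rfl, rfl⟩ := h5
      rw [hneg] at hps
      exact hs.2 _ hqs hps

/-- The vertices of the cross-polytope. -/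
theorem singleton_mem_crossPolytopeBoundary_iff {v : EuclideanSpace ℝ (Fin n)} :
    {v} ∈ crossPolytopeBoundary n ↔ ∃ i, v = basisVec i ∨ v = -basisVec i := by
  refine ⟨fun h => h.1 v (Finset.mem_singleton_self v), fun h => ⟨?_, ?_⟩⟩
  · intro w hw
    rwa [Finset.mem_singleton.1 hw]
  · intro w hw hc
    rw [Finset.mem_singleton] at hw hc
    subst hw
    have h0 : w = 0 := by
      have h2 : (2 : ℝ) • w = 0 := by
        rw [two_smul]
        nth_rewrite 1 [← hc]
        exact neg_add_cancel w
      simpa using h2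
    obtain ⟨i, hi | hi⟩ := h
    · have := congrArg (fun x => x i) (hi.symm.trans h0)
      simp [basisVec] at this
    · have := congrArg (fun x => x i) (hi.symm.trans h0)
      simp [basisVec] at this

end CrossPolytope

end RootComplex

/-! ### The fan of the cross-polytope and the cube -/

section CrossPolytopeFan

variable {n : ℕ}

theorem basisVec_apply (i k : Fin n) : basisVec i k = if k = i then (1 : ℝ) else 0 :=
  PiLp.single_apply ..

theorem inner_basisVec (i : Fin n) (x : EuclideanSpace ℝ (Fin n)) :
    inner ℝ (basisVec i) x = x i := by
  simp [basisVec, EuclideanSpace.inner_single_left]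

theorem basisVec_ne_neg (i j : Fin n) : (basisVec i : EuclideanSpace ℝ (Fin n)) ≠ -basisVec j := by
  intro h
  have := congrArg (fun x => x i) h
  simp only [basisVec_apply, PiLp.neg_apply, if_true] at this
  split_ifs at this <;> norm_num at this

/-- The coordinates of a combination of the vertices of the cross-polytope. -/
theorem linearCombination_apply_of_crossPolytope {c : EuclideanSpace ℝ (Fin n) →₀ ℝ}
    (hc : ∀ v ∈ c.support, ∃ i, v = basisVec i ∨ v = -basisVec i) (k : Fin n) :
    Finsupp.linearCombination ℝ id c k = c (basisVec k) - c (-basisVec k) := by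
  classical
  rw [← inner_basisVec, Finsupp.linearCombination_apply, Finsupp.sum, inner_sum]
  have hsub : ∑ v ∈ c.support, inner ℝ (basisVec k) (c v • id v) =
      ∑ v ∈ ({basisVec k, -basisVec k} : Finset (EuclideanSpace ℝ (Fin n))), c v * v k := by
    simp only [inner_basisVec, PiLp.smul_apply, id, smul_eq_mul]
    refine Finset.sum_congr_of_eq_on_inter ?_ ?_ fun _ _ _ => rfl
    · intro v hv hvn
      obtain ⟨i, hi⟩ := hc v hv
      have hik : k ≠ i := by
        rintro rfl
        exact hvn (by simpa using hi)
      rcases hi with rfl | rfl <;> simp [basisVec_apply, hik]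
    · intro v _ hvn
      rw [Finsupp.notMem_support_iff.1 hvn, zero_mul]
  rw [hsub, Finset.sum_pair (basisVec_ne_neg k k)]
  simp [basisVec_apply]
  ring

/-- The coefficients of e_k and -e_k have difference x k and are not both nonzero, so they are the
positive and negative parts of x k. -/
theorem hasUniqueConeReps_crossPolytopeBoundary :
    HasUniqueConeReps (crossPolytopeBoundary n) := by
  classical
  intro x
  let V : Finset (EuclideanSpace ℝ (Fin n)) :=
    Finset.univ.image basisVec ∪ Finset.univ.image fun i => -basisVec i
  have hV : ∀ v, v ∈ V ↔ ∃ i, v = basisVec i ∨ v = -basisVec i := by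
    intro v
    simp only [V, Finset.mem_union, Finset.mem_image, Finset.mem_univ, true_and, eq_comm (a := v)]
    rw [exists_or]
  let c : EuclideanSpace ℝ (Fin n) →₀ ℝ :=
    Finsupp.onFinset V (fun v => if v ∈ V then max (inner ℝ v x) 0 else 0) (by
      intro v hv
      by_contra hvV
      exact hv (if_neg hvV))
  have hc : ∀ v ∈ V, c v = max (inner ℝ v x) 0 := fun v hv => by
    simp only [c, Finsupp.onFinset_apply, if_pos hv]
  have hcV : ∀ v ∈ c.support, v ∈ V := fun v hv => Finsupp.support_onFinset_subset hv
  have hpos : ∀ v ∈ c.support, 0 < inner ℝ v x := by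
    intro v hv
    have h1 := Finsupp.mem_support_iff.1 hv
    rw [hc v (hcV v hv)] at h1
    by_contra! hle
    exact h1 (max_eq_right hle)
  refine ⟨c, ⟨fun v => ?_, ⟨fun v hv => (hV v).1 (hcV v hv), fun v hv hnv => ?_⟩, ?_⟩,
    fun d hd => ?_⟩
  · simp only [c, Finsupp.onFinset_apply]
    split_ifs
    exacts [le_max_right _ _, le_rfl]
  · have h1 := hpos v hv
    have h2 := hpos _ hnv
    rw [inner_neg_left] at h2
    linarith
  · ext k
    rw [linearCombination_apply_of_crossPolytope fun v hv => (hV v).1 (hcV v hv),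
      hc _ ((hV _).2 ⟨k, Or.inl rfl⟩), hc _ ((hV _).2 ⟨k, Or.inr rfl⟩), inner_neg_left,
      inner_basisVec]
    rcases le_total 0 (x k) with h | h
    · rw [max_eq_left h, max_eq_right (by linarith)]; ring
    · rw [max_eq_right h, max_eq_left (by linarith)]; ring
  · have hdV : ∀ v ∈ d.support, ∃ i, v = basisVec i ∨ v = -basisVec i := hd.support_mem.1
    have hzero : ∀ v, d v = 0 ∨ d (-v) = 0 := by
      intro v
      by_contra! h
      exact hd.support_mem.2 v (Finsupp.mem_support_iff.2 h.1) (Finsupp.mem_support_iff.2 h.2)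
    have hk : ∀ k, x k = d (basisVec k) - d (-basisVec k) := fun k => by
      rw [← linearCombination_apply_of_crossPolytope hdV, hd.sum_eq]
    ext v
    by_cases hv : v ∈ V
    · rw [hc v hv]
      obtain ⟨k, hk' | hk'⟩ := (hV v).1 hv
      · subst hk'
        rw [inner_basisVec, hk k]
        have h1 := hd.nonneg (basisVec k)
        have h2 := hd.nonneg (-basisVec k)
        rcases hzero (basisVec k) with h | h
        · rw [h, max_eq_right (by linarith)]
        · rw [h, max_eq_left (by linarith), sub_zero]
      · subst hk'
        rw [inner_neg_left, inner_basisVec, hk k]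
        have h1 := hd.nonneg (basisVec k)
        have h2 := hd.nonneg (-basisVec k)
        rcases hzero (basisVec k) with h | h
        · rw [h, max_eq_left (by linarith)]; ring
        · rw [h, max_eq_right (by linarith)]
    · have h1 : d v = 0 := Finsupp.notMem_support_iff.1 fun h => hv ((hV v).2 (hdV v h))
      have h2 : c v = 0 := Finsupp.notMem_support_iff.1 fun h => hv (hcV v h)
      rw [h1, h2]

theorem exists_tightExactly_crossPolytopeBoundary {s : Finset (EuclideanSpace ℝ (Fin n))}
    (hs : s ∈ crossPolytopeBoundary n) :
    ∃ x, TightExactly (crossPolytopeBoundary n) (fun _ => 1) s x := by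
  have hval : ∀ v w : EuclideanSpace ℝ (Fin n), (∃ i, v = basisVec i ∨ v = -basisVec i) →
      (∃ i, w = basisVec i ∨ w = -basisVec i) →
      (v = w ∧ inner ℝ v w = (1 : ℝ)) ∨ (v = -w ∧ inner ℝ v w ≤ (0 : ℝ)) ∨
        inner ℝ v w = (0 : ℝ) := by
    rintro v w ⟨i, hv⟩ ⟨j, hw⟩
    by_cases hij : i = j
    · subst hij
      have h1 : ‖(basisVec i : EuclideanSpace ℝ (Fin n))‖ = 1 := by simp [basisVec]
      rcases hv with rfl | rfl <;> rcases hw with rfl | rfl <;> simp [h1]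
    · right; right
      rcases hv with rfl | rfl <;> rcases hw with rfl | rfl <;>
        simp [inner_basisVec, basisVec_apply, hij]
  -- The centre of the dual face of the cube: entries ±1 in the directions occurring in s, and 0
  -- elsewhere.
  refine ⟨∑ v ∈ s, v, fun v hv => ?_⟩
  rw [singleton_mem_crossPolytopeBoundary_iff] at hv
  rw [inner_sum]
  constructor
  · intro hvs
    have h0 : ∀ w ∈ s, w ≠ v → inner ℝ v w = (0 : ℝ) := by
      intro w hw hwv
      rcases hval v w hv (hs.1 w hw) with ⟨h, -⟩ | ⟨h, -⟩ | h
      · exact absurd h.symm hwv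
      · exact absurd (h ▸ hvs) (hs.2 w hw)
      · exact h
    rw [Finset.sum_eq_single_of_mem v hvs h0]
    rcases hval v v hv hv with ⟨-, h⟩ | ⟨h, -⟩ | h
    · exact h
    · exact absurd (h ▸ hvs) (hs.2 v hvs)
    · rw [inner_self_eq_zero] at h
      exact absurd (by rw [h, neg_zero, ← h]; exact hvs) (hs.2 v hvs)
  · intro hvs
    refine lt_of_le_of_lt (Finset.sum_nonpos fun w hw => ?_) one_pos
    rcases hval v w hv (hs.1 w hw) with ⟨h, -⟩ | ⟨-, h⟩ | h
    · exact absurd (h ▸ hw) hvs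
    · exact h
    · exact h.le

theorem supportedPolytope_crossPolytopeBoundary :
    supportedPolytope (crossPolytopeBoundary n) (fun _ => 1) = cube n := by
  ext x
  simp only [supportedPolytope, cube, Set.mem_ofPred_eq, singleton_mem_crossPolytopeBoundary_iff,
    abs_le]
  constructor
  · intro h i
    have h1 := h _ ⟨i, Or.inl rfl⟩
    have h2 := h _ ⟨i, Or.inr rfl⟩
    rw [inner_basisVec] at h1
    rw [inner_neg_left, inner_basisVec] at h2
    constructor <;> linarith
  · rintro h v ⟨i, rfl | rfl⟩
    · rw [inner_basisVec]
      exact (h i).2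
    · rw [inner_neg_left, inner_basisVec]
      linarith [(h i).1]

end CrossPolytopeFan

/-! ### The order of the subdivisions -/

section FatteningPairs

variable {n : ℕ}

theorem mem_fatteningPairs {x : Fin n × Fin n} : x ∈ fatteningPairs n ↔ x.1 < x.2 := by
  obtain ⟨i, j⟩ := x
  simp [fatteningPairs]

theorem pairwise_fatteningPairs :
    (fatteningPairs n).Pairwise fun x y => y.1 < x.1 ∨ (x.1 = y.1 ∧ x.2 < y.2) := by
  rw [fatteningPairs, List.pairwise_flatMap]
  constructor
  · intro i _
    rw [List.pairwise_map]
    exact ((List.pairwise_lt_finRange n).filter _).imp fun h => Or.inr ⟨rfl, h⟩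
  · rw [List.pairwise_reverse]
    refine (List.pairwise_lt_finRange n).imp fun {a b} h => ?_
    simp only [List.mem_map, List.mem_filter]
    rintro _ ⟨_, -, rfl⟩ _ ⟨_, -, rfl⟩
    exact Or.inl h

/-- The labels of the first `k` pairs. -/
def processedPairs (n k : ℕ) : Set (ℕ × ℕ) :=
  {p | ∃ x ∈ (fatteningPairs n).take k, p = ((x.1 : ℕ) + 1, (x.2 : ℕ) + 1)}

theorem processedPairs_zero : processedPairs n 0 = ∅ := by
  simp [processedPairs]

theorem processedPairs_length : processedPairs n (fatteningPairs n).length = innerPairs n := by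
  ext ⟨i, j⟩
  simp only [processedPairs, List.take_length, mem_fatteningPairs, Set.mem_ofPred_eq, innerPairs,
    Prod.mk.injEq]
  constructor
  · rintro ⟨x, hx, rfl, rfl⟩
    rw [Fin.lt_def] at hx
    have := x.2.2
    omega
  · rintro ⟨h1, h2, h3⟩
    exact ⟨(⟨i - 1, by omega⟩, ⟨j - 1, by omega⟩), by rw [Fin.lt_def]; simp only; omega,
      by simp only; omega, by simp only; omega⟩

theorem processedPairs_succ {k : ℕ} (hk : k < (fatteningPairs n).length) :
    processedPairs n (k + 1) = insert ((((fatteningPairs n)[k]).1 : ℕ) + 1,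
      (((fatteningPairs n)[k]).2 : ℕ) + 1) (processedPairs n k) := by
  ext p
  simp only [processedPairs, List.take_add_one, List.getElem?_eq_getElem hk, Option.toList_some,
    List.mem_append, List.mem_singleton, Set.mem_insert_iff, Set.mem_ofPred_eq]
  constructor
  · rintro ⟨x, hx | rfl, rfl⟩
    · exact Or.inr ⟨x, hx, rfl⟩
    · exact Or.inl rfl
  · rintro (rfl | ⟨x, hx, rfl⟩)
    · exact ⟨_, Or.inr rfl, rfl⟩
    · exact ⟨x, Or.inl hx, rfl⟩

/-- The list is strictly sorted and contains every inner pair, so its first k entries are exactly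
the predecessors of the next one. This turns positions in the list into the order condition of the
subdivision step. -/
theorem processedPairs_eq_pairsBefore {k : ℕ} (hk : k < (fatteningPairs n).length) :
    processedPairs n k = pairsBefore n ((((fatteningPairs n)[k]).1 : ℕ) + 1)
      ((((fatteningPairs n)[k]).2 : ℕ) + 1) := by
  have hpw := List.pairwise_iff_getElem.1 (pairwise_fatteningPairs (n := n))
  have hall := processedPairs_length (n := n)
  ext ⟨i, j⟩
  rw [mem_pairsBefore]
  constructor
  · rintro ⟨x, hx, hxp⟩
    rw [Prod.mk.injEq] at hxp
    obtain ⟨rfl, rfl⟩ := hxp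
    have hx' := mem_fatteningPairs.1 (List.mem_of_mem_take hx)
    obtain ⟨r, hr, rfl⟩ := List.mem_take_iff_getElem.1 hx
    have := hpw r k (by omega) hk (by omega)
    have h2 := ((fatteningPairs n)[r]).2.2
    simp only [Fin.lt_def, Fin.ext_iff] at this hx'
    omega
  · rintro ⟨hp, hlt⟩
    have hp' : (i, j) ∈ processedPairs n (fatteningPairs n).length := by rw [hall]; exact hp
    obtain ⟨x, hx, hxp⟩ := hp'
    rw [List.take_length] at hx
    obtain ⟨r, hr, rfl⟩ := List.mem_iff_getElem.1 hx
    refine ⟨_, List.mem_take_iff_getElem.2 ⟨r, ?_, rfl⟩, hxp⟩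
    rw [Prod.mk.injEq] at hxp
    rw [lt_min_iff]
    refine ⟨?_, hr⟩
    by_contra! hkr
    rcases hkr.eq_or_lt with rfl | hkr
    · omega
    · have := hpw k r hk hr hkr
      simp only [Fin.lt_def, Fin.ext_iff] at this
      omega

end FatteningPairs

/-! ### The final complex is the associahedron -/

section AssociahedronIso

variable {n : ℕ}

theorem isLabel_innerPairs_iff {p : ℕ × ℕ} : IsLabel n (innerPairs n) p ↔ IsRoot n p := by
  obtain ⟨i, j⟩ := p
  simp only [IsLabel, IsRoot, innerPairs, Set.mem_ofPred_eq, ne_eq, Prod.mk.injEq]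
  omega

/-- An exempt pair would have 1 ≤ q.1 < p.2 ≤ n, the last because p is not (0, n + 1); then (q.1,
p.2) is an inner pair, so no exemption is left. -/
theorem conflict_innerPairs_iff {p q : ℕ × ℕ} (hp : IsRoot n p) :
    Conflict n (innerPairs n) p q ↔ p.1 < q.1 ∧ q.1 ≤ p.2 ∧ p.2 < q.2 := by
  obtain ⟨i, j⟩ := p
  obtain ⟨k, l⟩ := q
  simp only [Conflict, IsRoot, innerPairs, Set.mem_ofPred_eq, ne_eq, Prod.mk.injEq] at hp ⊢
  omega

theorem mem_rootComplex_innerPairs {s : Finset (EuclideanSpace ℝ (Fin n))} :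
    s ∈ rootComplex n (innerPairs n) ↔ (∀ x ∈ s, ∃ p, IsRoot n p ∧ rootVec n p = x) ∧
      ∀ p q, IsRoot n p → IsRoot n q → rootVec n p ∈ s → rootVec n q ∈ s →
        ¬ (p.1 < q.1 ∧ q.1 ≤ p.2 ∧ p.2 < q.2) := by
  rw [mem_rootComplex]
  simp only [isLabel_innerPairs_iff]
  refine and_congr_right fun _ => forall₄_congr fun p q hp hq => ?_
  rw [conflict_innerPairs_iff hp]

/-- An isomorphism of complexes from an injection of the vertices. -/
theorem complexIso_of_injOn {V W : Type*} {K : LowerSet (Finset V)} {L : LowerSet (Finset W)}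
    (f : W → V) (hf : Set.InjOn f (complexVertices L))
    (himage : f '' complexVertices L = complexVertices K)
    (hface : ∀ s : Finset W, (∀ w ∈ s, w ∈ complexVertices L) → ∀ t : Finset V,
      (t : Set V) = f '' s → (t ∈ K ↔ s ∈ L)) : ComplexIso K L := by
  classical
  have hbij : Set.BijOn f (complexVertices L) (complexVertices K) :=
    ⟨fun w hw => himage ▸ Set.mem_image_of_mem f hw, hf, himage.ge⟩
  let e : complexVertices L ≃ complexVertices K := hbij.equiv f
  refine ⟨e.symm, fun s => hface _ ?_ _ ?_⟩
  · intro w hw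
    obtain ⟨x, -, rfl⟩ := Finset.mem_map.1 hw
    exact x.2
  · ext v
    simp only [Finset.coe_map, Set.image_image, Function.Embedding.subtype_apply,
      Equiv.coe_toEmbedding, Set.mem_image]
    refine exists_congr fun x => and_congr_right fun _ => ?_
    have : (e (e.symm x) : V) = f (e.symm x) := rfl
    rw [← this, Equiv.apply_symm_apply]

theorem exists_map_subtype_eq {V : Type*} {K : LowerSet (Finset V)} (s : K) :
    ∃ t : Finset (complexVertices K), t.map (Function.Embedding.subtype _) = s.1 := by
  classical
  refine ⟨s.1.subtype (· ∈ complexVertices K), ?_⟩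
  rw [Finset.subtype_map_of_mem]
  exact fun v hv => singleton_mem_of_mem s.2 hv

theorem ComplexIso.nonempty_orderIso {V W : Type*} {K : LowerSet (Finset V)}
    {L : LowerSet (Finset W)} (h : ComplexIso K L) : Nonempty (K ≃o L) := by
  classical
  obtain ⟨φ, hφ⟩ := h
  choose r hr using exists_map_subtype_eq (K := K)
  let f : K ↪o L := OrderEmbedding.ofMapLEIff
    (fun s => ⟨((r s).map φ.toEmbedding).map (Function.Embedding.subtype _),
      (hφ (r s)).1 (by rw [hr]; exact s.2)⟩) fun s t => by
        change ((r s).map φ.toEmbedding).map (Function.Embedding.subtype _) ⊆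
          ((r t).map φ.toEmbedding).map (Function.Embedding.subtype _) ↔ s.1 ⊆ t.1
        rw [Finset.map_subset_map, Finset.map_subset_map, ← hr s, ← hr t, Finset.map_subset_map]
  refine ⟨RelIso.ofSurjective f fun t => ?_⟩
  obtain ⟨t', ht'⟩ := exists_map_subtype_eq t
  have htt : (t'.map φ.symm.toEmbedding).map φ.toEmbedding = t' := by
    ext; simp
  have hmem : (t'.map φ.symm.toEmbedding).map (Function.Embedding.subtype _) ∈ K := by
    rw [hφ, htt, ht']
    exact t.2
  refine ⟨⟨_, hmem⟩, Subtype.ext ?_⟩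
  change ((r ⟨_, hmem⟩).map φ.toEmbedding).map (Function.Embedding.subtype _) = t.1
  have hrt : r ⟨_, hmem⟩ = t'.map φ.symm.toEmbedding :=
    Finset.map_injective (Function.Embedding.subtype _) (hr ⟨_, hmem⟩)
  rw [hrt, htt, ht']

/-- The pair of indices of a diagonal. -/
def diagonalLabel (d : Fin (n + 3) × Fin (n + 3)) : ℕ × ℕ := (d.1, d.2 - 1)

theorem IsDiagonal.isRoot {d : Fin (n + 3) × Fin (n + 3)} (hd : IsDiagonal d) :
    IsRoot n (diagonalLabel d) := by
  have := d.2.2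
  simp only [IsDiagonal, IsRoot, diagonalLabel, ne_eq, Prod.mk.injEq] at hd ⊢
  omega

theorem IsRoot.exists_diagonal {p : ℕ × ℕ} (hp : IsRoot n p) :
    ∃ d : Fin (n + 3) × Fin (n + 3), IsDiagonal d ∧ diagonalLabel d = p := by
  obtain ⟨i, j⟩ := p
  simp only [IsRoot, ne_eq, Prod.mk.injEq] at hp
  refine ⟨(⟨i, by omega⟩, ⟨j + 1, by omega⟩), ?_, by simp [diagonalLabel]⟩
  simp only [IsDiagonal]
  omega

theorem diagonalLabel_injOn :
    Set.InjOn diagonalLabel {d : Fin (n + 3) × Fin (n + 3) | IsDiagonal d} := by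
  rintro d (hd : IsDiagonal d) e (he : IsDiagonal e) h
  simp only [IsDiagonal, diagonalLabel, Prod.mk.injEq] at hd he h
  ext <;> omega

/-- Labels lower the second endpoint by one, which turns the middle strict inequality of alternation
into a weak one. -/
theorem crosses_iff {d e : Fin (n + 3) × Fin (n + 3)} (hd : IsDiagonal d) (he : IsDiagonal e) :
    Crosses d e ↔
      ((diagonalLabel d).1 < (diagonalLabel e).1 ∧ (diagonalLabel e).1 ≤ (diagonalLabel d).2 ∧
        (diagonalLabel d).2 < (diagonalLabel e).2) ∨
      ((diagonalLabel e).1 < (diagonalLabel d).1 ∧ (diagonalLabel d).1 ≤ (diagonalLabel e).2 ∧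
        (diagonalLabel e).2 < (diagonalLabel d).2) := by
  simp only [IsDiagonal, diagonalLabel, Crosses, Fin.lt_def] at hd he ⊢
  omega

theorem singleton_mem_associahedron_iff {d : Fin (n + 3) × Fin (n + 3)} :
    d ∈ complexVertices (associahedron n) ↔ IsDiagonal d := by
  refine ⟨fun h => h.1 d (Finset.mem_singleton_self d), fun h => ⟨?_, ?_⟩⟩
  · intro e he
    rwa [Finset.mem_singleton.1 he]
  · intro e he e' he'
    rw [Finset.mem_singleton.1 he, Finset.mem_singleton.1 he']
    rintro (h | h) <;> exact lt_irrefl _ h.1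

theorem complexIso_associahedron :
    ComplexIso (rootComplex n (innerPairs n)) (associahedron n) := by
  have hvert : ∀ x, x ∈ complexVertices (rootComplex n (innerPairs n)) ↔
      ∃ p, IsRoot n p ∧ rootVec n p = x := fun x => by
    simp only [← isLabel_innerPairs_iff]
    exact singleton_mem_rootComplex_iff subset_rfl
  have hinj : Set.InjOn (rootVec n ∘ diagonalLabel) (complexVertices (associahedron n)) := by
    intro d hd e he h
    rw [singleton_mem_associahedron_iff] at hd he
    exact diagonalLabel_injOn hd he (rootVec_injOn hd.isRoot he.isRoot h)
  refine complexIso_of_injOn (rootVec n ∘ diagonalLabel) hinj ?_ ?_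
  · ext x
    rw [hvert]
    constructor
    · rintro ⟨d, hd, rfl⟩
      exact ⟨_, (singleton_mem_associahedron_iff.1 hd).isRoot, rfl⟩
    · rintro ⟨p, hp, rfl⟩
      obtain ⟨d, hd, rfl⟩ := hp.exists_diagonal
      exact ⟨d, singleton_mem_associahedron_iff.2 hd, rfl⟩
  · intro s hs t hts
    replace hs : ∀ d ∈ s, IsDiagonal d := fun d hd => singleton_mem_associahedron_iff.1 (hs d hd)
    have ht : ∀ x, x ∈ t ↔ ∃ d ∈ s, rootVec n (diagonalLabel d) = x := fun x => by
      rw [← Finset.mem_coe, hts]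
      rfl
    rw [mem_rootComplex_innerPairs]
    constructor
    · rintro ⟨-, h⟩
      refine ⟨hs, fun d hd e he hc => ?_⟩
      have hde := h _ _ (hs d hd).isRoot (hs e he).isRoot ((ht _).2 ⟨d, hd, rfl⟩)
        ((ht _).2 ⟨e, he, rfl⟩)
      have hed := h _ _ (hs e he).isRoot (hs d hd).isRoot ((ht _).2 ⟨e, he, rfl⟩)
        ((ht _).2 ⟨d, hd, rfl⟩)
      rcases (crosses_iff (hs d hd) (hs e he)).1 hc with h | h
      exacts [hde h, hed h]
    · rintro ⟨-, h⟩
      refine ⟨fun x hx => ?_, fun p q hp hq hpt hqt hc => ?_⟩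
      · obtain ⟨d, hd, rfl⟩ := (ht x).1 hx
        exact ⟨_, (hs d hd).isRoot, rfl⟩
      · obtain ⟨d, hd, hdp⟩ := (ht _).1 hpt
        obtain ⟨e, he, heq⟩ := (ht _).1 hqt
        obtain rfl := rootVec_injOn (hs d hd).isRoot hp hdp
        obtain rfl := rootVec_injOn (hs e he).isRoot hq heq
        exact h d hd e he ((crosses_iff (hs d hd) (hs e he)).2 (Or.inl hc))

end AssociahedronIso

/-! ### Interval sums of Loday coordinates and blocks of trees -/

section LodayTrees

/-- The sum of the Loday coordinates of a tree in the positions `i ≤ k < j`. -/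
def blockSum (t : BinaryTree Unit) (i j : ℕ) : ℕ :=
  ∑ k ∈ Finset.Ico i j, (lodayCoords t).getD k 0

/-- The positions `i ≤ k < j` are those of the nodes of a subtree of `t`. -/
def IsBlock : BinaryTree Unit → ℕ → ℕ → Prop
  | .nil, _, _ => False
  | .node _ l r, i, j => (i = 0 ∧ j = l.numNodes + r.numNodes + 1) ∨ IsBlock l i j ∨
      ∃ i' j', i = l.numNodes + 1 + i' ∧ j = l.numNodes + 1 + j' ∧ IsBlock r i' j'

theorem length_lodayCoords (t : BinaryTree Unit) : (lodayCoords t).length = t.numNodes := by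
  induction t with
  | nil => rfl
  | node a l r hl hr => simp [lodayCoords, hl, hr]; omega

section Node

variable (a : Unit) (l r : BinaryTree Unit)

theorem blockSum_node_left {i j : ℕ} (hj : j ≤ l.numNodes) :
    blockSum (.node a l r) i j = blockSum l i j := by
  refine Finset.sum_congr rfl fun k hk => ?_
  rw [lodayCoords, List.getD_append]
  rw [length_lodayCoords]
  exact (Finset.mem_Ico.1 hk).2.trans_le hj

theorem blockSum_node_right (i j : ℕ) :
    blockSum (.node a l r) (l.numNodes + 1 + i) (l.numNodes + 1 + j) = blockSum r i j := by
  rw [blockSum, blockSum, add_comm (l.numNodes + 1), add_comm (l.numNodes + 1),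
    ← Finset.sum_Ico_add' _ i j (l.numNodes + 1)]
  refine Finset.sum_congr rfl fun k _ => ?_
  rw [lodayCoords, List.getD_append_right _ _ _ _ (by rw [length_lodayCoords]; omega),
    length_lodayCoords, show k + (l.numNodes + 1) - l.numNodes = k + 1 by omega,
    List.getD_cons_succ]

theorem blockSum_node_root : (lodayCoords (.node a l r)).getD l.numNodes 0 =
    (l.numNodes + 1) * (r.numNodes + 1) := by
  rw [lodayCoords, List.getD_append_right _ _ _ _ (length_lodayCoords l).le, length_lodayCoords,
    Nat.sub_self, List.getD_cons_zero, BinaryTree.numLeaves_eq_numNodes_succ,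
    BinaryTree.numLeaves_eq_numNodes_succ]

theorem blockSum_node_middle {i j : ℕ} (hi : i ≤ l.numNodes) :
    blockSum (.node a l r) i (l.numNodes + 1 + j) =
      blockSum l i l.numNodes + (l.numNodes + 1) * (r.numNodes + 1) + blockSum r 0 j := by
  rw [← blockSum_node_left a l r le_rfl, ← blockSum_node_right a l r, ← blockSum_node_root a l r,
    add_zero, blockSum, blockSum, blockSum, ← Finset.sum_Ico_succ_top hi,
    Finset.sum_Ico_consecutive _ (by omega) (by omega)]

end Node

theorem blockSum_total (t : BinaryTree Unit) :
    2 * blockSum t 0 t.numNodes = t.numNodes * (t.numNodes + 1) := by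
  induction t with
  | nil => rfl
  | node a l r hl hr =>
    have h := blockSum_node_middle a l r (j := r.numNodes) (Nat.zero_le _)
    have hn : (BinaryTree.node a l r).numNodes = l.numNodes + 1 + r.numNodes := by
      rw [BinaryTree.numNodes]; omega
    rw [hn, h]
    linear_combination hl + hr

/-- An interval on one side of the root is handled by induction. One containing the root, with p
positions to its left and q to its right, gains the root coordinate, which is at least (p + 1) * (q
+ 1) with equality only if the interval is everything. Empty intervals give equality without being
blocks. -/
theorem le_blockSum (t : BinaryTree Unit) : ∀ i d, i + d ≤ t.numNodes →
    d * (d + 1) ≤ 2 * blockSum t i (i + d) ∧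
      (d * (d + 1) = 2 * blockSum t i (i + d) → d = 0 ∨ IsBlock t i (i + d)) := by
  induction t with
  | nil =>
    intro i d h
    have : d = 0 := by simp at h; omega
    subst this
    simp
  | node a l r hl hr =>
    intro i d h
    rw [BinaryTree.numNodes] at h
    rcases Nat.lt_or_ge l.numNodes (i + d) with h1 | h1
    · rcases Nat.lt_or_ge l.numNodes i with h2 | h2
      · obtain ⟨i', rfl⟩ := Nat.exists_eq_add_of_le (Nat.succ_le_of_lt h2)
        obtain ⟨h3, h4⟩ := hr i' d (by omega)
        have h5 := blockSum_node_right a l r i' (i' + d)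
        rw [← add_assoc] at h5
        rw [Nat.succ_eq_add_one, h5]
        refine ⟨h3, fun heq => (h4 heq).imp_right fun hb => Or.inr (Or.inr ⟨i', i' + d, rfl, ?_, hb⟩)⟩
        omega
      · obtain ⟨p, hp⟩ := Nat.exists_eq_add_of_le h2
        obtain ⟨q, hq⟩ := Nat.exists_eq_add_of_le (Nat.succ_le_of_lt h1)
        rw [Nat.succ_eq_add_one] at hq
        have h3 := (hl i p (by omega)).1
        have h4 := (hr 0 q (by omega)).1
        rw [← hp] at h3
        rw [zero_add] at h4
        rw [hq, blockSum_node_middle a l r h2]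
        obtain rfl : d = p + 1 + q := by omega
        have hpl : p + 1 ≤ l.numNodes + 1 := by omega
        have hqr : q + 1 ≤ r.numNodes + 1 := by omega
        have hmul := Nat.mul_le_mul hpl hqr
        -- The triangular numbers of p and q and the product (p + 1) * (q + 1) add up to the
        -- triangular number of p + q + 1.
        have hexp : (p + 1 + q) * (p + 1 + q + 1) =
            p * (p + 1) + q * (q + 1) + 2 * ((p + 1) * (q + 1)) := by ring
        refine ⟨by omega, fun heq => Or.inr (Or.inl ?_)⟩
        have hmul' : (p + 1) * (q + 1) = (l.numNodes + 1) * (r.numNodes + 1) := by omega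
        have hpe : p = l.numNodes := by
          by_contra hne
          have h5 : p + 1 < l.numNodes + 1 := by omega
          exact absurd hmul' (Nat.mul_lt_mul_of_lt_of_le h5 hqr (Nat.succ_pos _)).ne
        have hqe : q = r.numNodes := by
          by_contra hne
          have h5 : q + 1 < r.numNodes + 1 := by omega
          exact absurd hmul' (Nat.mul_lt_mul_of_le_of_lt hpl h5 (Nat.succ_pos _)).ne
        omega
    · rw [blockSum_node_left a l r h1]
      obtain ⟨h3, h4⟩ := hl i d h1
      exact ⟨h3, fun heq => (h4 heq).imp_right fun hb => Or.inr (Or.inl hb)⟩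

theorem IsBlock.blockSum_eq {t : BinaryTree Unit} : ∀ {i j : ℕ}, IsBlock t i j →
    i < j ∧ j ≤ t.numNodes ∧ 2 * blockSum t i j = (j - i) * (j - i + 1) := by
  induction t with
  | nil => exact fun h => h.elim
  | node a l r hl hr =>
    rintro i j (⟨rfl, rfl⟩ | h | ⟨i', j', rfl, rfl, h⟩)
    · exact ⟨Nat.succ_pos _, le_rfl, blockSum_total (.node a l r)⟩
    · obtain ⟨h1, h2, h3⟩ := hl h
      refine ⟨h1, by rw [BinaryTree.numNodes]; omega, ?_⟩
      rw [blockSum_node_left a l r h2, h3]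
    · obtain ⟨h1, h2, h3⟩ := hr h
      refine ⟨by omega, by rw [BinaryTree.numNodes]; omega, ?_⟩
      rw [blockSum_node_right, h3, Nat.add_sub_add_left]

/-- An interval contained in no member of a family of pairwise noncrossing intervals has a point
covered by none of them. -/
theorem exists_notMem_of_noncrossing {s : Set (ℕ × ℕ)} {N k l : ℕ} (hsN : ∀ p ∈ s, p.2 ≤ N)
    (hs : ∀ p ∈ s, ∀ q ∈ s, ¬ (p.1 < q.1 ∧ q.1 ≤ p.2 ∧ p.2 < q.2)) (hkl : k < l)
    (hI : ∀ p ∈ s, ¬ (p.1 ≤ k ∧ l ≤ p.2)) :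
    ∃ m, k ≤ m ∧ m < l ∧ ∀ p ∈ s, ¬ (p.1 ≤ m ∧ m < p.2) := by
  by_cases hcov : ∃ p ∈ s, p.1 ≤ k ∧ k < p.2
  -- Among the members covering k, take the largest right endpoint. It is below l, as no member
  -- contains the interval. A member covering it would either cover k and end later, or start after
  -- k and cross the chosen member.
  · let T : Set ℕ := {j | ∃ p ∈ s, p.1 ≤ k ∧ k < p.2 ∧ p.2 = j}
    have hT : T.Nonempty := by
      obtain ⟨p, hp, h1, h2⟩ := hcov
      exact ⟨_, p, hp, h1, h2, rfl⟩
    have hbdd : BddAbove T := ⟨N, by rintro _ ⟨p, hp, -, -, rfl⟩; exact hsN p hp⟩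
    obtain ⟨p, hp, h1, h2, h3⟩ := Nat.sSup_mem hT hbdd
    have hmax : ∀ q ∈ s, q.1 ≤ k → k < q.2 → q.2 ≤ p.2 := fun q hq h4 h5 => by
      rw [h3]
      exact le_csSup hbdd ⟨q, hq, h4, h5, rfl⟩
    have := hI p hp
    refine ⟨p.2, h2.le, by omega, fun q hq hc => ?_⟩
    have h6 := hmax q hq
    have h7 := hs p hp q hq
    omega
  · push Not at hcov
    exact ⟨k, le_rfl, hkl, fun p hp hc => absurd hc.2 (hcov p hp hc.1).not_gt⟩

/-- A family of pairwise noncrossing intervals is contained in the family of blocks of a tree, and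
any other interval can be avoided. -/
theorem exists_tree_of_noncrossing (N : ℕ) : ∀ s : Set (ℕ × ℕ),
    (∀ p ∈ s, p.1 < p.2 ∧ p.2 ≤ N) →
    (∀ p ∈ s, ∀ q ∈ s, ¬ (p.1 < q.1 ∧ q.1 ≤ p.2 ∧ p.2 < q.2)) →
    ∀ k l : ℕ, (k < l → l ≤ N → (k, l) ∉ s ∧ (k, l) ≠ (0, N)) →
    ∃ t : BinaryTree Unit, t.numNodes = N ∧ (∀ p ∈ s, IsBlock t p.1 p.2) ∧ ¬ IsBlock t k l := by
  induction N using Nat.strong_induction_on with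
  | _ N ih =>
  intro s hsN hs k l hI
  rcases N.eq_zero_or_pos with rfl | hN
  · exact ⟨.nil, rfl, fun p hp => by have := hsN p hp; omega, id⟩
  -- the position of the root
  obtain ⟨m, hmN, hm, hmI⟩ : ∃ m, m < N ∧
      (∀ p ∈ s, p = (0, N) ∨ p.2 ≤ m ∨ m < p.1) ∧
      (k < l → l ≤ N → (k, l) ≠ (0, m) ∧ (k, l) ≠ (m + 1, N)) := by
    have hs' : ∀ p ∈ s \ {(0, N)}, ∀ q ∈ s \ {(0, N)},
        ¬ (p.1 < q.1 ∧ q.1 ≤ p.2 ∧ p.2 < q.2) := fun p hp q hq => hs p hp.1 q hq.1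
    have hsN' : ∀ p ∈ s \ {(0, N)}, p.2 ≤ N := fun p hp => (hsN p hp.1).2
    have hconv : ∀ m, (∀ p ∈ s \ {(0, N)}, ¬ (p.1 ≤ m ∧ m < p.2)) →
        ∀ p ∈ s, p = (0, N) ∨ p.2 ≤ m ∨ m < p.1 := by
      intro m hm p hp
      by_cases hp0 : p = (0, N)
      · exact Or.inl hp0
      · have := hm p ⟨hp, hp0⟩
        omega
    simp only [ne_eq, Prod.mk.injEq] at hI ⊢
    -- If no member other than the whole interval contains [k, l), the root is put inside it, so it
    -- cannot be a side of the root. Otherwise a strictly larger member lies on one side of any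
    -- admissible root, so again [k, l) is not a full side; it is avoided by recursion.
    by_cases hex : k < l ∧ l ≤ N ∧ ∀ p ∈ s \ {(0, N)}, ¬ (p.1 ≤ k ∧ l ≤ p.2)
    · obtain ⟨m, h1, h2, h3⟩ := exists_notMem_of_noncrossing hsN' hs' hex.1 hex.2.2
      exact ⟨m, by omega, hconv m h3, fun h4 h5 => by have := (hI h4 h5).2; omega⟩
    · obtain ⟨m, h1, h2, h3⟩ := exists_notMem_of_noncrossing hsN' hs' hN (by
        rintro ⟨i, j⟩ hp ⟨h1, h2⟩
        have := hsN' _ hp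
        exact hp.2 (Prod.ext (by simp only at h1 ⊢; omega) (by simp only at h2 this ⊢; omega)))
      refine ⟨m, by omega, hconv m h3, fun h4 h5 => ?_⟩
      push Not at hex
      obtain ⟨p, hp, h6, h7⟩ := hex h4 h5
      have h8 := h3 p hp
      have h9 := hsN' p hp
      have hpI : p ≠ (k, l) := fun h => (hI h4 h5).1 (h ▸ hp.1)
      rw [ne_eq, Prod.ext_iff] at hpI
      omega
  obtain ⟨tl, hl1, hl2, hl3⟩ := ih m hmN {p | p ∈ s ∧ p.2 ≤ m} (fun p hp => ⟨(hsN p hp.1).1, hp.2⟩)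
    (fun p hp q hq => hs p hp.1 q hq.1) k l fun h1 h2 =>
      ⟨fun h => (hI h1 (h2.trans hmN.le)).1 h.1, (hmI h1 (h2.trans hmN.le)).1⟩
  have hright : ∀ i j, (i < j → j ≤ N - (m + 1) →
      (i, j) ∉ {p : ℕ × ℕ | (m + 1 + p.1, m + 1 + p.2) ∈ s} ∧ (i, j) ≠ (0, N - (m + 1))) →
      ∃ t : BinaryTree Unit, t.numNodes = N - (m + 1) ∧
        (∀ p ∈ {p : ℕ × ℕ | (m + 1 + p.1, m + 1 + p.2) ∈ s}, IsBlock t p.1 p.2) ∧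
        ¬ IsBlock t i j := by
    intro i j hij
    refine ih (N - (m + 1)) (by omega) _ (fun p hp => ?_) (fun p hp q hq hc => ?_) i j hij
    · have := hsN _ hp
      simp only at this
      omega
    · refine hs _ hp _ hq ?_
      simp only
      omega
  obtain ⟨tr, hr1, hr2, hr3⟩ : ∃ t : BinaryTree Unit, t.numNodes = N - (m + 1) ∧
      (∀ p ∈ {p : ℕ × ℕ | (m + 1 + p.1, m + 1 + p.2) ∈ s}, IsBlock t p.1 p.2) ∧
      (m + 1 ≤ k → m + 1 ≤ l → ¬ IsBlock t (k - (m + 1)) (l - (m + 1))) := by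
    by_cases hkl : m + 1 ≤ k ∧ m + 1 ≤ l
    · obtain ⟨k, rfl⟩ := Nat.exists_eq_add_of_le hkl.1
      obtain ⟨l, rfl⟩ := Nat.exists_eq_add_of_le hkl.2
      simp only [Nat.add_sub_cancel_left]
      obtain ⟨t, h1, h2, h3⟩ := hright k l fun h4 h5 => ⟨(hI (by omega) (by omega)).1, by
        have := (hmI (by omega) (by omega)).2
        simp only [ne_eq, Prod.mk.injEq] at this ⊢
        omega⟩
      exact ⟨t, h1, h2, fun _ _ => h3⟩
    -- Nothing has to be avoided on the right; the pair (1, 0) makes the hypothesis vacuous.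
    · obtain ⟨t, h1, h2, -⟩ := hright 1 0 fun h => absurd h (by omega)
      exact ⟨t, h1, h2, fun h3 h4 => absurd ⟨h3, h4⟩ hkl⟩
  refine ⟨.node () tl tr, ?_, fun p hp => ?_, ?_⟩
  · rw [BinaryTree.numNodes]
    omega
  · rcases hm p hp with rfl | h | h
    · exact Or.inl ⟨rfl, by simp only; omega⟩
    · exact Or.inr (Or.inl (hl2 p ⟨hp, h⟩))
    · have h1 := hsN p hp
      have h2 : m + 1 + (p.1 - (m + 1)) = p.1 := by omega
      have h3 : m + 1 + (p.2 - (m + 1)) = p.2 := by omega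
      refine Or.inr (Or.inr ⟨p.1 - (m + 1), p.2 - (m + 1), by omega, by omega,
        hr2 (p.1 - (m + 1), p.2 - (m + 1)) ?_⟩)
      simp only [Set.mem_ofPred_eq, h2, h3]
      exact hp
  · rintro (⟨h1, h2⟩ | h | ⟨i, j, h1, h2, h3⟩)
    · exact (hI (by omega) (by omega)).2 (Prod.ext h1 (by simp only; omega))
    · exact hl3 h
    · rw [hl1] at h1 h2
      refine hr3 (by omega) (by omega) ?_
      rwa [h1, h2, Nat.add_sub_cancel_left, Nat.add_sub_cancel_left]

end LodayTrees

/-! ### Loday's polytope and its normal fan -/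

section LodayPolytope

variable {n : ℕ}

/-- The differences of consecutive coordinates. -/
noncomputable def consecutiveDifferences (n : ℕ) :
    EuclideanSpace ℝ (Fin (n + 1)) →ₗ[ℝ] EuclideanSpace ℝ (Fin n) where
  toFun x := WithLp.toLp 2 fun k => x k.castSucc - x k.succ
  map_add' x y := by
    ext k
    simp only [PiLp.add_apply]
    ring
  map_smul' r x := by
    ext k
    simp only [PiLp.smul_apply, smul_eq_mul, RingHom.id_apply]
    ring

theorem consecutiveDifferences_apply (x : EuclideanSpace ℝ (Fin (n + 1))) (k : Fin n) :
    consecutiveDifferences n x k = x k.castSucc - x k.succ := rfl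

theorem apply_eq_of_consecutiveDifferences_eq_zero {c : EuclideanSpace ℝ (Fin (n + 1))}
    (hc : consecutiveDifferences n c = 0) (i : Fin (n + 1)) : c i = c 0 := by
  induction i using Fin.induction with
  | zero => rfl
  | succ k ih =>
    have := congrArg (fun x => x k) hc
    simp only [consecutiveDifferences_apply, PiLp.zero_apply] at this
    linarith

theorem ker_consecutiveDifferences : LinearMap.ker (consecutiveDifferences n) =
    Submodule.span ℝ {WithLp.toLp 2 (fun _ => (1 : ℝ))} := by
  ext c
  rw [LinearMap.mem_ker, Submodule.mem_span_singleton]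
  constructor
  · intro hc
    refine ⟨c 0, ?_⟩
    ext i
    rw [apply_eq_of_consecutiveDifferences_eq_zero hc i]
    simp
  · rintro ⟨r, rfl⟩
    ext k
    simp [consecutiveDifferences_apply]

theorem consecutiveDifferences_surjective : Function.Surjective (consecutiveDifferences n) := by
  intro y
  -- Negated partial sums of y, whose consecutive differences are the entries of y.
  refine ⟨WithLp.toLp 2 fun i => -∑ k : Fin n, if (k : ℕ) < i then y k else 0, ?_⟩
  ext k
  rw [consecutiveDifferences_apply]
  simp only [Fin.val_castSucc, Fin.val_succ]
  rw [neg_sub_neg, ← Finset.sum_sub_distrib, Finset.sum_eq_single k]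
  · simp
  · intro l _ hl
    have : (l : ℕ) ≠ k := fun h => hl (Fin.ext h)
    by_cases h : (l : ℕ) < k
    · rw [if_pos h, if_pos (by omega), sub_self]
    · rw [if_neg h, if_neg (by omega), sub_self]
  · simp

/-- The point of a tree. -/
noncomputable def treePoint (n : ℕ) (t : BinaryTree Unit) : EuclideanSpace ℝ (Fin (n + 1)) :=
  WithLp.toLp 2 fun i => ((lodayCoords t).getD i 0 : ℝ)

/-- The outer normal of the facet inequality for the sum of the coordinates in an interval. -/
noncomputable def intervalNormal (n : ℕ) (p : ℕ × ℕ) : EuclideanSpace ℝ (Fin (n + 1)) :=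
  WithLp.toLp 2 fun i => if p.1 ≤ i ∧ (i : ℕ) < p.2 then -1 else 0

/-- The negated indicator of an interval jumps only at its two ends. An end at 0 or n + 1 gives no
jump inside, in agreement with e_0 = e_{n+1} = 0. -/
theorem consecutiveDifferences_intervalNormal {p : ℕ × ℕ} (hp : p.1 < p.2) :
    consecutiveDifferences n (intervalNormal n p) = rootVec n p := by
  ext k
  rw [consecutiveDifferences_apply, rootVec_apply]
  simp only [intervalNormal, Fin.val_castSucc, Fin.val_succ]
  split_ifs <;> first | omega | norm_num

theorem inner_intervalNormal_treePoint {p : ℕ × ℕ} (hp : p.2 ≤ n + 1) (t : BinaryTree Unit) :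
    inner ℝ (intervalNormal n p) (treePoint n t) = -(blockSum t p.1 p.2 : ℝ) := by
  rw [PiLp.inner_apply]
  simp only [intervalNormal, treePoint, RCLike.inner_apply, conj_trivial, mul_ite, mul_neg, mul_one,
    mul_zero]
  rw [Fin.sum_univ_eq_sum_range
    (fun i => if p.1 ≤ i ∧ i < p.2 then -((lodayCoords t).getD i 0 : ℝ) else 0) (n + 1),
    ← Finset.sum_filter, blockSum, Nat.cast_sum, ← Finset.sum_neg_distrib]
  refine Finset.sum_congr ?_ fun _ _ => rfl
  ext i
  simp only [Finset.mem_filter, Finset.mem_range, Finset.mem_Ico]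
  omega

/-- The maximum of `intervalNormal n p` on the Loday associahedron. -/
noncomputable def intervalBound (p : ℕ × ℕ) : ℝ :=
  -(((p.2 - p.1) * (p.2 - p.1 + 1) : ℕ) : ℝ) / 2

theorem inner_treePoint_le {p : ℕ × ℕ} (hp : p.1 < p.2) (hpn : p.2 ≤ n + 1)
    {t : BinaryTree Unit} (ht : t.numNodes = n + 1) :
    inner ℝ (intervalNormal n p) (treePoint n t) ≤ intervalBound p ∧
      (inner ℝ (intervalNormal n p) (treePoint n t) = intervalBound p ↔ IsBlock t p.1 p.2) := by
  rw [inner_intervalNormal_treePoint hpn, intervalBound]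
  obtain ⟨h1, h2⟩ := le_blockSum t p.1 (p.2 - p.1) (by omega)
  rw [Nat.add_sub_of_le hp.le] at h1 h2
  constructor
  · have : (((p.2 - p.1) * (p.2 - p.1 + 1) : ℕ) : ℝ) ≤ ((2 * blockSum t p.1 p.2 : ℕ) : ℝ) :=
      Nat.cast_le.2 h1
    rw [Nat.cast_mul 2] at this
    push_cast at this ⊢
    linarith
  · constructor
    · intro h
      refine (h2 ?_).resolve_left (by omega)
      rw [← Nat.cast_inj (R := ℝ), Nat.cast_mul 2]
      push_cast at h ⊢
      linarith
    · intro h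
      rw [← h.blockSum_eq.2.2]
      push_cast
      ring

theorem treePoint_mem {t : BinaryTree Unit} (ht : t.numNodes = n + 1) :
    treePoint n t ∈ lodayAssociahedron n :=
  subset_convexHull ℝ _ ⟨t, ht, rfl⟩

theorem inner_intervalNormal_le {p : ℕ × ℕ} (hp : p.1 < p.2) (hpn : p.2 ≤ n + 1)
    {x : EuclideanSpace ℝ (Fin (n + 1))} (hx : x ∈ lodayAssociahedron n) :
    inner ℝ (intervalNormal n p) x ≤ intervalBound p := by
  have hconv : Convex ℝ {x | innerₛₗ ℝ (intervalNormal n p) x ≤ intervalBound p} :=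
    convex_halfSpace_le (innerₛₗ ℝ (intervalNormal n p)).isLinear _
  refine convexHull_min ?_ hconv hx
  rintro _ ⟨t, ht, rfl⟩
  exact (inner_treePoint_le hp hpn ht).1

/-- Such a c has equal entries, so it is a multiple of the coordinate sum. This sum is the same at
all tree points, because the whole interval is a block of every tree. -/
theorem inner_eq_of_consecutiveDifferences_eq_zero {c : EuclideanSpace ℝ (Fin (n + 1))}
    (hc : consecutiveDifferences n c = 0) {x : EuclideanSpace ℝ (Fin (n + 1))}
    (hx : x ∈ lodayAssociahedron n) :
    inner ℝ c x = -(c 0 * intervalBound (0, n + 1)) := by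
  have hconv : Convex ℝ {x | innerₛₗ ℝ c x = -(c 0 * intervalBound (0, n + 1))} :=
    convex_hyperplane (innerₛₗ ℝ c).isLinear _
  refine convexHull_min ?_ hconv hx
  rintro _ ⟨t, ht, rfl⟩
  have hcn : c = -c 0 • intervalNormal n (0, n + 1) := by
    ext i
    rw [apply_eq_of_consecutiveDifferences_eq_zero hc i]
    simp [intervalNormal, i.is_le]
  have hblock : IsBlock t 0 (n + 1) := by
    cases t with
    | nil => simp at ht
    | node a l r => exact Or.inl ⟨rfl, ht.symm⟩
  have h := (inner_treePoint_le (p := (0, n + 1)) n.succ_pos le_rfl ht).2.2 hblock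
  change inner ℝ c (treePoint n t) = _
  calc inner ℝ c (treePoint n t)
      = inner ℝ (-c 0 • intervalNormal n (0, n + 1)) (treePoint n t) := by rw [← hcn]
    _ = _ := by rw [real_inner_smul_left, h, neg_mul]

/-- For each root outside s some tree has all of s among its blocks but not that root. Repeated
midpoints of such tree points keep s tight and make the other inequalities strict one by one. -/
theorem exists_mem_loday_tight {s : Set (ℕ × ℕ)} (hs : ∀ p ∈ s, IsRoot n p)
    (hcross : ∀ p ∈ s, ∀ q ∈ s, ¬ (p.1 < q.1 ∧ q.1 ≤ p.2 ∧ p.2 < q.2)) :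
    ∃ x ∈ lodayAssociahedron n, (∀ p ∈ s, inner ℝ (intervalNormal n p) x = intervalBound p) ∧
      ∀ p, IsRoot n p → p ∉ s → inner ℝ (intervalNormal n p) x < intervalBound p := by
  have htree := exists_tree_of_noncrossing (n + 1) s (fun p hp => ⟨(hs p hp).1, (hs p hp).2.1⟩)
    hcross
  have key : ∀ A : Finset (ℕ × ℕ), ∃ x ∈ lodayAssociahedron n,
      (∀ p ∈ s, inner ℝ (intervalNormal n p) x = intervalBound p) ∧
      ∀ p ∈ A, IsRoot n p → p ∉ s → inner ℝ (intervalNormal n p) x < intervalBound p := by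
    intro A
    induction A using Finset.induction_on with
    | empty =>
      obtain ⟨t, ht, hts, -⟩ := htree 1 0 fun h => absurd h (by omega)
      exact ⟨_, treePoint_mem ht, fun p hp =>
        (inner_treePoint_le (hs p hp).1 (hs p hp).2.1 ht).2.2 (hts p hp), by simp⟩
    | insert q A _ ih =>
      obtain ⟨x, hx, hxs, hxA⟩ := ih
      by_cases hq : IsRoot n q ∧ q ∉ s
      · obtain ⟨t, ht, hts, htq⟩ := htree q.1 q.2 fun _ _ => ⟨hq.2, hq.1.2.2⟩
        have hval : ∀ c, inner ℝ c ((1 / 2 : ℝ) • x + (1 / 2 : ℝ) • treePoint n t) =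
            (inner ℝ c x + inner ℝ c (treePoint n t)) / 2 := fun c => by
          rw [inner_add_right, inner_smul_right, inner_smul_right]
          ring
        refine ⟨(1 / 2 : ℝ) • x + (1 / 2 : ℝ) • treePoint n t,
          convex_convexHull ℝ _ hx (treePoint_mem ht) (by norm_num) (by norm_num) (by norm_num),
          fun p hp => ?_, fun p hpA hp hps => ?_⟩
        · rw [hval, hxs p hp, (inner_treePoint_le (hs p hp).1 (hs p hp).2.1 ht).2.2 (hts p hp)]
          ring
        · rw [hval]
          have h1 := inner_intervalNormal_le hp.1 hp.2.1 hx
          have h2 := inner_treePoint_le hp.1 hp.2.1 ht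
          rcases Finset.mem_insert.1 hpA with rfl | hpA
          · have := lt_of_le_of_ne h2.1 fun h => htq (h2.2.1 h)
            linarith
          · have := hxA p hpA hp hps
            linarith [h2.1]
      · refine ⟨x, hx, hxs, fun p hpA hp hps => ?_⟩
        rcases Finset.mem_insert.1 hpA with rfl | hpA
        · exact absurd ⟨hp, hps⟩ hq
        · exact hxA p hpA hp hps
  -- A finite box containing all roots.
  obtain ⟨x, hx, hxs, hxA⟩ := key (Finset.range (n + 2) ×ˢ Finset.range (n + 2))
  refine ⟨x, hx, hxs, fun p hp => hxA p ?_ hp⟩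
  have h1 := hp.1
  have h2 := hp.2.1
  rw [Finset.mem_product, Finset.mem_range, Finset.mem_range]
  omega

/-- Every lift of a root differs from its interval normal by a functional constant on the polytope,
and the bound of that normal is attained; so maximality of the lifts is tightness of the interval
inequality. -/
theorem exposesFaces_lodayAssociahedron :
    ExposesFaces (consecutiveDifferences n) (lodayAssociahedron n)
      (rootComplex n (innerPairs n)) where
  surjective := consecutiveDifferences_surjective
  inner_eq := fun c hc x hx y hy => by
    rw [inner_eq_of_consecutiveDifferences_eq_zero hc hx,
      inner_eq_of_consecutiveDifferences_eq_zero hc hy]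
  exists_point := by
    intro s hs
    rw [mem_rootComplex_innerPairs] at hs
    obtain ⟨x, hx, hxs, hxn⟩ := exists_mem_loday_tight (n := n)
      (s := {p | IsRoot n p ∧ rootVec n p ∈ s}) (fun p hp => hp.1)
      (fun p hp q hq => hs.2 p q hp.1 hq.1 hp.2 hq.2)
    refine ⟨x, hx, fun v hv => ?_⟩
    obtain ⟨p, hp, rfl⟩ := (singleton_mem_rootComplex_iff subset_rfl).1 hv
    rw [isLabel_innerPairs_iff] at hp
    have hL := consecutiveDifferences_intervalNormal (n := n) hp.1
    constructor
    · intro hmax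
      by_contra hps
      have hlt := hxn p hp fun h => hps h.2
      obtain ⟨y, hy, hys, -⟩ := exists_mem_loday_tight (n := n) (s := {p})
        (by rintro _ rfl; exact hp) (by rintro _ rfl _ rfl h; exact lt_irrefl _ h.1)
      have hle := hmax _ hL y hy
      rw [hys p rfl] at hle
      exact hle.not_gt hlt
    · intro hps c hc y hy
      have hker : consecutiveDifferences n (c - intervalNormal n p) = 0 := by
        rw [map_sub, hc, hL, sub_self]
      have h1 := inner_eq_of_consecutiveDifferences_eq_zero hker hx
      rw [← inner_eq_of_consecutiveDifferences_eq_zero hker hy, inner_sub_left,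
        inner_sub_left] at h1
      have h2 := inner_intervalNormal_le hp.1 hp.2.1 hy
      have h3 := hxs p ⟨hp, hps⟩
      linarith

end LodayPolytope

/-! ### Assembly of the two sequences -/

theorem card_edge {V : Type*} {u v : V} (huv : u ≠ v) : (edge u v).card = 2 := by
  classical
  exact Finset.card_pair huv

/-- Support numbers are chosen one step at a time, each choice depending on the previous one; the
invariant G is carried along because the next choice needs it. -/
theorem exists_seq_of_step {α : Type*} (G : ℕ → α → Prop) (R : ℕ → α → α → Prop) (a : α)
    (h0 : G 0 a) (step : ∀ k a, G k a → ∃ b, G (k + 1) b ∧ R k a b) :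
    ∃ f : ℕ → α, f 0 = a ∧ ∀ k, G k (f k) ∧ R k (f k) (f (k + 1)) := by
  choose next hnext using step
  let f : ∀ k, {a // G k a} := fun k =>
    Nat.rec ⟨a, h0⟩ (fun k x => ⟨next k x.1 x.2, (hnext k x.1 x.2).1⟩) k
  exact ⟨fun k => (f k).1, rfl, fun k => ⟨(f k).2, (hnext k (f k).1 (f k).2).2⟩⟩

theorem corollary3p3 (n : ℕ) (hn : 1 ≤ n) :
    ∃ (K : ℕ → LowerSet (Finset (EuclideanSpace ℝ (Fin n))))
      (P : ℕ → Set (EuclideanSpace ℝ (Fin n))),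
      -- from the boundary of the cross-polytope to the simplicial associahedron,
      -- by stellar subdivisions of edges, each subdivision vertex being the sum of the edge
      K 0 = crossPolytopeBoundary n ∧
      (∀ (k : ℕ) (hk : k < (fatteningPairs n).length),
        let u := basisVec ((fatteningPairs n)[k]).1
        let v := -basisVec ((fatteningPairs n)[k]).2
        u ≠ v ∧ edge u v ∈ K k ∧ u + v ∉ complexVertices (K k) ∧
          K (k + 1) = stellarSubdivision (K k) (edge u v) (u + v)) ∧
      ComplexIso (K (fatteningPairs n).length) (associahedron n) ∧
      -- from the cube to the dual of the simplicial associahedron,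
      -- by truncations of the faces of codimension two that are dual to these edges
      P 0 = cube n ∧
      (∀ (k : ℕ) (hk : k < (fatteningPairs n).length),
        ∃ F : Set (EuclideanSpace ℝ (Fin n)),
          IsFace (P k) F ∧ Module.finrank ℝ (vectorSpan ℝ F) + 2 = n ∧
          normalCone (P k) F =
            (PointedCone.hull ℝ {basisVec ((fatteningPairs n)[k]).1,
              -basisVec ((fatteningPairs n)[k]).2} : Set (EuclideanSpace ℝ (Fin n))) ∧
          IsTruncation (P k) F (P (k + 1))) ∧
      Nonempty ({F // IsFace (P (fatteningPairs n).length) F} ≃o (associahedron n)ᵒᵈ) ∧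
      -- all along, the rays realize the complex, and the fan is the normal fan of the polytope
      (∀ k ≤ (fatteningPairs n).length,
        RealizesCompleteSimplicialFan (K k) ∧ normalFan (P k) = coneFan (K k)) ∧
      -- the final fan is, up to a linear isomorphism, the normal fan of the associahedron of Loday
      -- modulo its lineality space
      ∃ L : EuclideanSpace ℝ (Fin (n + 1)) →ₗ[ℝ] EuclideanSpace ℝ (Fin n),
        Function.Surjective L ∧
        LinearMap.ker L = Submodule.span ℝ {WithLp.toLp 2 (fun _ => (1 : ℝ))} ∧
        normalFan (lodayAssociahedron n) =
          (fun C => L ⁻¹' C) '' coneFan (K (fatteningPairs n).length) := by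
  set m := (fatteningPairs n).length with hm
  let K : ℕ → LowerSet (Finset (EuclideanSpace ℝ (Fin n))) :=
    fun k => rootComplex n (processedPairs n k)
  have hK0 : K 0 = crossPolytopeBoundary n := by
    simp only [K, processedPairs_zero, rootComplex_empty]
  have hKm : K m = rootComplex n (innerPairs n) := by
    simp only [K, hm, processedPairs_length]
  have hfin : ∀ k, (complexVertices (K k)).Finite := by
    intro k
    refine finite_complexVertices_rootComplex ?_
    rw [← processedPairs_length]
    rintro _ ⟨x, hx, rfl⟩
    exact ⟨x, by rw [List.take_length]; exact List.mem_of_mem_take hx, rfl⟩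
  have hstep : ∀ (k : ℕ) (hk : k < m),
      let u := basisVec ((fatteningPairs n)[k]).1
      let v := -basisVec ((fatteningPairs n)[k]).2
      u ≠ v ∧ edge u v ∈ K k ∧ u + v ∉ complexVertices (K k) ∧
        K (k + 1) = stellarSubdivision (K k) (edge u v) (u + v) := by
    intro k hk u v
    have hlt : ((fatteningPairs n)[k]).1 < ((fatteningPairs n)[k]).2 :=
      mem_fatteningPairs.1 (List.getElem_mem hk)
    rw [Fin.lt_def] at hlt
    have h1 : 1 ≤ (((fatteningPairs n)[k]).1 : ℕ) + 1 := Nat.succ_pos _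
    have h2 := Nat.add_lt_add_right hlt 1
    have h3 : (((fatteningPairs n)[k]).2 : ℕ) + 1 ≤ n := ((fatteningPairs n)[k]).2.2
    have huv : u + v = rootVec n (_, _) := (rootVec_succ _ _).symm
    refine ⟨basisVec_ne_neg _ _, ?_, ?_, ?_⟩
    · simp only [K, u, v, processedPairs_eq_pairsBefore hk, ← rootVec_last, ← rootVec_zero]
      exact edge_mem_rootComplex h1 h2 h3
    · rw [huv]
      simp only [K, processedPairs_eq_pairsBefore hk]
      exact rootVec_notMem_complexVertices h1 h2 h3
    · rw [huv]
      simp only [K, u, v, processedPairs_succ hk, processedPairs_eq_pairsBefore hk,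
        ← rootVec_last, ← rootVec_zero]
      exact rootComplex_insert h1 h2 h3
  have hcone : ∀ k ≤ m, HasUniqueConeReps (K k) := by
    intro k
    induction k with
    | zero =>
      intro _
      rw [hK0]
      exact hasUniqueConeReps_crossPolytopeBoundary
    | succ k ih =>
      intro hk
      obtain ⟨h1, h2, h3, h4⟩ := hstep k hk
      rw [h4]
      exact (ih (Nat.le_of_succ_le hk)).stellarSubdivision h1 h2 h3
  -- Invariant and relation are guarded by the bound m, so that the recursion can be continued
  -- trivially beyond the last pair.
  obtain ⟨h, hh0, hh⟩ := exists_seq_of_step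
    (fun k h => k ≤ m → ∀ s ∈ K k, ∃ x, TightExactly (K k) h s x)
    (fun k h h' => ∀ hk : k < m, IsTruncation (supportedPolytope (K k) h)
      (dualFace LinearMap.id (supportedPolytope (K k) h)
        (edge (basisVec ((fatteningPairs n)[k]).1) (-basisVec ((fatteningPairs n)[k]).2)))
      (supportedPolytope (K (k + 1)) h'))
    (fun _ => 1) (fun _ s hs => by
      rw [hK0] at hs ⊢
      exact exists_tightExactly_crossPolytopeBoundary hs) (by
      intro k h hG
      by_cases hk : k < m
      · obtain ⟨h1, h2, h3, h4⟩ := hstep k hk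
        obtain ⟨h', h5, h6⟩ := exists_truncation_of_stellarSubdivision (hcone k hk.le) (hfin k)
          (hG hk.le) h1 h2 h3
        rw [← h4] at h5 h6
        exact ⟨h', fun _ => h5, fun _ => h6⟩
      · exact ⟨h, fun hc => absurd hc hk, fun hc => absurd hc hk⟩)
  have htight : ∀ k ≤ m, ∀ s ∈ K k, ∃ x, TightExactly (K k) (h k) s x := fun k => (hh k).1
  have hexp : ∀ k ≤ m, ExposesFaces LinearMap.id (supportedPolytope (K k) (h k)) (K k) :=
    fun k hk => exposesFaces_supportedPolytope (htight k hk)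
  have hiso : ComplexIso (K m) (associahedron n) := hKm ▸ complexIso_associahedron
  refine ⟨K, fun k => supportedPolytope (K k) (h k), hK0, hstep, hiso, ?_, ?_, ?_, ?_,
    consecutiveDifferences n, consecutiveDifferences_surjective, ker_consecutiveDifferences, ?_⟩
  · simp only [hh0, hK0]
    exact supportedPolytope_crossPolytopeBoundary
  · intro k hk
    obtain ⟨h1, h2, -, -⟩ := hstep k hk
    refine ⟨_, (hexp k hk.le).isFace_dualFace h2, ?_, ?_, (hh k).2 hk⟩
    · have hrank := finrank_vectorSpan_dualFace (hfin k) (htight k hk.le) h2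
        ((hcone k hk.le).realizes.simplicial _ h2)
      rw [finrank_euclideanSpace_fin] at hrank
      rwa [card_edge h1] at hrank
    · rw [(hexp k hk.le).normalCone_dualFace (hcone k hk.le) h2]
      simp [edge]
  · obtain ⟨e⟩ := (hexp m le_rfl).nonempty_orderIso (hcone m le_rfl)
    obtain ⟨f⟩ := hiso.nonempty_orderIso
    exact ⟨e.symm.trans f.dual⟩
  · intro k hk
    refine ⟨(hcone k hk).realizes, ?_⟩
    rw [(hexp k hk).normalFan_eq (hcone k hk)]
    simp
  · have := (exposesFaces_lodayAssociahedron (n := n)).normalFan_eq (hKm ▸ hcone m le_rfl)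
    rwa [hKm]
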